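/- **Setting.** For $v\in\mathbb R^3$ let $\hat v=(1+|v|^2)^{-1/2}v$, let $K(x)=\frac{1}{4\pi}\frac{x}{|x|^3}$ on $\mathbb R^3$, and let $\mathcal K=\eta*K$, where $\eta\in C_c^\infty(\mathbb R^3)$, $\eta\ge 0$, $\int_{\mathbb R^3}\eta=1$. Let $\sigma_E\in\{0,\pm1\}$ and $\sigma_B\in\{0,1\}$. Write $\mathcal L^6$ for Lebesgue measure on $\mathbb R^6=\mathbb R^3_x\times\mathbb R^3_v$ and $f_t=f(t,\cdot)$. **Maximal regular flow.** Let $T>0$ and let $b:(0,T)\times\mathbb R^6\to\mathbb R^6$ be a Borel vector field. A maximal regular flow of $b$ consists, for every $s\in[0,T]$, of Borel functions $T_s^-\colon\mathbb R^6\to[0,s)$ and $T_s^+\colon\mathbb R^6\to(s,T]$ (with $T^-_0=0$ and $T^+_T=T$) and a Borel map $X(\cdot,s,\cdot)$, with $X(\cdot,s,z)$ defined on $I_s(z)=(T_s^-(z),T_s^+(z))\cup\{s\}$, such that: (i) for a.e. $z$, $X(\cdot,s,z)$ is absolutely continuous on every compact interval contained in $I_s(z)$, solves $\dot X=b_t(X)$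 a.e. on $I_s(z)$, and $X(s,s,z)=z$; (ii) there is $C=C(s)$ with $X(t,s,\cdot)_\#(\mathcal L^6\llcorner\{z: t\in I_s(z)\})\le C\mathcal L^6$ for all $t\in[0,T]$; (iii) for a.e. $z$, either $T_s^+(z)=T$ and $X(\cdot,s,z)$ is (or extends to be) continuous on $[s,T]$, or $|X(t,s,z)|\to\infty$ as $t\uparrow T_s^+(z)$; and either $T_s^-(z)=0$ and $X(\cdot,s,z)$ is (or extends to be) continuous on $[0,s]$, or $|X(t,s,z)|\to\infty$ as $t\downarrow T_s^-(z)$. **Lagrangian solution.** Let $\rho\in L^\infty((0,T);L^1_{\rm loc}(\mathbb R^6))$ be nonnegative, weakly continuous on $[0,T]$ in duality with $C_c(\mathbb R^6)$, and a distributional solution of $\partial_t\rho_t+\nabla\cdot(b_t\rho_t)=0$ in $(0,T)\times\mathbb R^6$ (with $b\rho$ locally integrable). It is a Lagrangian solution on $[0,T]$ if $b$ has a maximal regular flow $X$ and there is a finite nonnegative Borel measure $\Lambda$ on $C([0,T];\mathbb R^6\cup\{\infty\})$ (one-point compactification, uniform convergence) whose image under $\gamma\mapsto\gamma(t)$ is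 $\rho_t\mathcal L^6$ for every $t\in[0,T]$, and such that for every $s\in[0,T]$, for $\Lambda$-a.e. $\gamma$, either $\gamma(s)=\infty$ or $\gamma=X(\cdot,s,\gamma(s))$ on $(T_s^-(\gamma(s)),T_s^+(\gamma(s)))$. **Proposition 3.3.** Let $g\in C_c^\infty(\mathbb R^6)$ be nonnegative. Then there exists a unique nonnegative $f\in C^\infty([0,\infty)\times\mathbb R^6)$ with the following properties: for every $t\ge0$, $f_t\in L^1(\mathbb R^6)$ and $f_t(x,\cdot)\in L^1(\mathbb R^3)$ for every $x$; $f$ satisfies pointwise $$ \begin{cases} \partial_t f_t+\hat v\cdot\nabla_x f_t+(E_t+\hat v\times B_t)\cdot\nabla_v f_t=0 & \text{in }(0,\infty)\times\mathbb R^3\times\mathbb R^3,\\ \rho_t(x)=\int_{\mathbb R^3}f_t(x,v)\,dv,\quad J_t(x)=\int_{\mathbb R^3}\hat v f_t(x,v)\,dv,\\ E_t(x)=\sigma_E\int_{\mathbb R^3}\rho_t(y)\,\mathcal K(x-y)\,dy,\\ B_t(x)=\sigma_B\int_{\mathbb R^3}J_t(y)\times\mathcal K(x-y)\,dy,\\ f_0=g;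 \end{cases} $$ and for every $T>0$, $f$ is a Lagrangian solution on $[0,T]$ for the vector field $b_t(x,v)=(\hat v,\,E_t(x)+\hat v\times B_t(x))$. -/

import Mathlib

open Set MeasureTheory Filter Topology
open scoped ContDiff NNReal ENNReal Convolution

noncomputable section

namespace RelativisticVlasov

/-- Euclidean three-space. -/
abbrev Space : Type := EuclideanSpace ℝ (Fin 3)

/-- Phase space `ℝ³ × ℝ³ = ℝ⁶` of pairs `(x, v)`; its `volume` is six-dimensional Lebesgue
measure. -/
abbrev Phase : Type := Space × Space

/-- The cross product of `ℝ³`. -/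
def cross (a b : Space) : Space :=
  WithLp.toLp 2 (crossProduct (WithLp.ofLp a) (WithLp.ofLp b))

/-- The relativistic velocity `v̂ = (1 + |v|²)^{-1/2} v`. -/
def relVelocity (v : Space) : Space := (Real.sqrt (1 + ‖v‖ ^ 2))⁻¹ • v

/-- The Coulomb / Biot-Savart kernel `K(x) = (4π)⁻¹ x / |x|³`. -/
def coulombKernel (x : Space) : Space := ((4 * Real.pi)⁻¹ * (‖x‖ ^ 3)⁻¹) • x

/-- The mollified kernel `η ∗ K`, that is `x ↦ ∫ η(y) K(x - y) dy`. -/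
def mollifiedKernel (η : Space → ℝ) : Space → Space :=
  η ⋆[ContinuousLinearMap.lsmul ℝ ℝ, volume] coulombKernel

/-! ### The self-consistent fields of a phase-space density -/

/-- The density `ρ(x) = ∫ h(x, v) dv`. -/
def chargeDensity (h : Phase → ℝ) (x : Space) : ℝ := ∫ v, h (x, v)

/-- The current density `J(x) = ∫ v̂ h(x, v) dv`. -/
def currentDensity (h : Phase → ℝ) (x : Space) : Space := ∫ v, h (x, v) • relVelocity v

/-- The electric (or gravitational) field `E(x) = σ_E ∫ ρ(y) 𝒦(x - y) dy`. -/
def electricField (𝒦 : Space → Space) (σE : ℝ) (h : Phase → ℝ) (x : Space) : Space :=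
  σE • ∫ y, chargeDensity h y • 𝒦 (x - y)

/-- The magnetic field `B(x) = σ_B ∫ J(y) × 𝒦(x - y) dy`. -/
def magneticField (𝒦 : Space → Space) (σB : ℝ) (h : Phase → ℝ) (x : Space) : Space :=
  σB • ∫ y, cross (currentDensity h y) (𝒦 (x - y))

/-- The acceleration `E(x) + v̂ × B(x)`. -/
def acceleration (𝒦 : Space → Space) (σE σB : ℝ) (h : Phase → ℝ) (x v : Space) : Space :=
  electricField 𝒦 σE h x + cross (relVelocity v) (magneticField 𝒦 σB h x)

/-- The phase-space vector field `b_t(x, v) = (v̂, E_t(x) + v̂ × B_t(x))` generated by `f`. -/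
def vlasovField (𝒦 : Space → Space) (σE σB : ℝ) (f : ℝ → Phase → ℝ) (t : ℝ) (z : Phase) : Phase :=
  (relVelocity z.2, acceleration 𝒦 σE σB (f t) z.1 z.2)

/-! ### Maximal regular flows -/

/-- The set of times on which the trajectory starting at time `s` from `z` is defined. For
`0 < s < T` it is the open interval `(T⁻, T⁺)`, which contains `s`; for `s = 0` it is `[0, T⁺)`,
and for `s = T` it is `(T⁻, T]`. -/
def lifespan (Tm Tp : ℝ → Phase → ℝ) (s : ℝ) (z : Phase) : Set ℝ :=
  insert s (Ioo (Tm s z) (Tp s z))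

/-- `X`, with existence times `Tm = T⁻` and `Tp = T⁺`, is a maximal regular flow of the vector field
`b` on the time interval `[0, T]`: the point `X t s z` is the position at time `t` of the trajectory
which starts at time `s` from `z`. Values of `X` outside the lifespan are irrelevant, except for the
continuous extension up to the end points `0` and `T`. -/
structure IsMaximalRegularFlow (b : ℝ → Phase → Phase) (T : ℝ) (Tm Tp : ℝ → Phase → ℝ)
    (X : ℝ → ℝ → Phase → Phase) : Prop where
  measurable_Tm : ∀ s ∈ Icc 0 T, Measurable (Tm s)
  measurable_Tp : ∀ s ∈ Icc 0 T, Measurable (Tp s)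
  /-- `T⁻` takes values in `[0, s)` (and vanishes if `s = 0`). -/
  Tm_mem : ∀ s ∈ Icc 0 T, ∀ z, 0 ≤ Tm s z ∧ Tm s z ≤ s ∧ (0 < s → Tm s z < s)
  /-- `T⁺` takes values in `(s, T]` (and equals `T` if `s = T`). -/
  Tp_mem : ∀ s ∈ Icc 0 T, ∀ z, s ≤ Tp s z ∧ Tp s z ≤ T ∧ (s < T → s < Tp s z)
  /-- `X(·, s, ·)` is Borel on its domain. -/
  measurable_flow : ∀ s ∈ Icc 0 T,
    Measurable ({p : ℝ × Phase | p.1 ∈ lifespan Tm Tp s p.2}.domRestrict fun p => X p.1 s p.2)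
  /-- Almost every trajectory is locally absolutely continuous, starts from `z` at time `s`,
  and solves the differential equation almost everywhere. -/
  trajectory : ∀ s ∈ Icc 0 T, ∀ᵐ z : Phase,
    (∀ a c : ℝ, a ≤ c → Icc a c ⊆ lifespan Tm Tp s z →
      AbsolutelyContinuousOnInterval (fun t => X t s z) a c) ∧
    X s s z = z ∧
    ∀ᵐ t : ℝ, t ∈ Ioo (Tm s z) (Tp s z) → HasDerivAt (fun τ => X τ s z) (b t (X t s z)) t
  /-- Bounded compression. -/
  compression : ∀ s ∈ Icc 0 T, ∃ C : ℝ≥0, ∀ t ∈ Icc 0 T,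
    (volume.restrict {z : Phase | t ∈ lifespan Tm Tp s z}).map (X t s) ≤ C • (volume : Measure Phase)
  /-- Forward maximality. -/
  forward : ∀ s ∈ Icc 0 T, ∀ᵐ z : Phase,
    (Tp s z = T ∧ ContinuousOn (fun t => X t s z) (Icc s T)) ∨
      Tendsto (fun t => ‖X t s z‖) (𝓝[<] (Tp s z)) atTop
  /-- Backward maximality. -/
  backward : ∀ s ∈ Icc 0 T, ∀ᵐ z : Phase,
    (Tm s z = 0 ∧ ContinuousOn (fun t => X t s z) (Icc 0 s)) ∨
      Tendsto (fun t => ‖X t s z‖) (𝓝[>] (Tm s z)) atTop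

/-! ### Transported measures and Lagrangian solutions -/

/-- The Borel σ-algebra of the one-point compactification of `ℝ⁶`. -/
instance instMeasurableSpaceOnePointPhase : MeasurableSpace (OnePoint Phase) := borel _

/-- Continuous curves `[0, T] → ℝ⁶ ∪ {∞}`, with the topology of uniform convergence. -/
abbrev PathSpace (T : ℝ) : Type := C(Icc (0 : ℝ) T, OnePoint Phase)

/-- The Borel σ-algebra of the path space. -/
instance instMeasurableSpacePathSpace (T : ℝ) : MeasurableSpace (PathSpace T) := borel _

/-- The measure `μ` on `ℝ⁶` seen as a measure on `ℝ⁶ ∪ {∞}` which does not charge `∞`. -/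
def onCompactification (μ : Measure Phase) : Measure (OnePoint Phase) :=
  μ.map fun z : Phase => (z : OnePoint Phase)

/-- The finite measure `Λ` on the path space, with absolutely continuous time marginals, is
transported by the maximal regular flow `X`. -/
structure IsTransported {T : ℝ} (Λ : Measure (PathSpace T)) (Tm Tp : ℝ → Phase → ℝ)
    (X : ℝ → ℝ → Phase → Phase) : Prop where
  finite : IsFiniteMeasure Λ
  marginal : ∀ t : Icc (0 : ℝ) T, Λ.map (fun γ => γ t) ≪ onCompactification volume
  /-- For every `s`, for `Λ`-almost every curve `γ`: either `γ(s) = ∞`, or `γ` coincides with the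
  trajectory of `X` through `γ(s)` at time `s`, as long as the latter exists. -/
  concentrated : ∀ s : Icc (0 : ℝ) T, ∀ᵐ γ ∂Λ, ∀ z : Phase, γ s = (z : OnePoint Phase) →
    ∀ t : Icc (0 : ℝ) T, (t : ℝ) ∈ Ioo (Tm s z) (Tp s z) →
      γ t = (X t s z : OnePoint Phase)

/-- `ρ` is a solution of `∂_t ρ + ∇ · (b ρ) = 0` in `(0, T) × ℝ⁶` in the sense of distributions. -/
def IsDistributionalSolution (b : ℝ → Phase → Phase) (T : ℝ) (ρ : ℝ → Phase → ℝ) : Prop :=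
  LocallyIntegrableOn (fun p : ℝ × Phase => ρ p.1 p.2 • b p.1 p.2) (Ioo 0 T ×ˢ univ) ∧
  ∀ φ : ℝ × Phase → ℝ, ContDiff ℝ ∞ φ → HasCompactSupport φ → tsupport φ ⊆ Ioo 0 T ×ˢ univ →
    ∫ p : ℝ × Phase, fderiv ℝ φ p (1, b p.1 p.2) * ρ p.1 p.2 = 0

/-- `ρ` is a Lagrangian solution on `[0, T]` of the continuity equation with vector field `b`. -/
structure IsLagrangianSolution (b : ℝ → Phase → Phase) (T : ℝ) (ρ : ℝ → Phase → ℝ) : Prop where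
  /-- `b` is a Borel vector field on `(0, T) × ℝ⁶`. -/
  measurable_field : Measurable ((Ioo 0 T ×ˢ univ).domRestrict fun p : ℝ × Phase => b p.1 p.2)
  nonneg : ∀ t ∈ Icc 0 T, 0 ≤ᵐ[volume] ρ t
  /-- `ρ` belongs to `L^∞((0, T); L¹_loc(ℝ⁶))`. -/
  measurable_density :
    AEStronglyMeasurable (fun p : ℝ × Phase => ρ p.1 p.2) (volume.restrict (Ioo 0 T ×ˢ univ))
  locally_bounded : ∀ S : Set Phase, IsCompact S → ∃ M : ℝ≥0,
    ∀ᵐ t ∂(volume.restrict (Ioo 0 T)), ∫⁻ z in S, ‖ρ t z‖ₑ ≤ M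
  distributional : IsDistributionalSolution b T ρ
  /-- `ρ` is weakly continuous on `[0, T]` in duality with `C_c(ℝ⁶)`. -/
  locallyIntegrable : ∀ t ∈ Icc 0 T, LocallyIntegrable (ρ t)
  weakly_continuous : ∀ φ : Phase → ℝ, Continuous φ → HasCompactSupport φ →
    ContinuousOn (fun t => ∫ z, φ z * ρ t z) (Icc 0 T)
  /-- `b` has a maximal regular flow, and there is a measure on curves transported by it whose
  marginal at every time `t ∈ [0, T]` is `ρ_t ℒ⁶`. -/
  transported : ∃ (Tm Tp : ℝ → Phase → ℝ) (X : ℝ → ℝ → Phase → Phase) (Λ : Measure (PathSpace T)),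
    IsMaximalRegularFlow b T Tm Tp X ∧ IsTransported Λ Tm Tp X ∧
    ∀ t : Icc (0 : ℝ) T, Λ.map (fun γ => γ t) =
      onCompactification (volume.withDensity fun z => ENNReal.ofReal (ρ t z))

/-! ### Smooth Lagrangian solutions of the relativistic Vlasov system -/

/-- `f` is a nonnegative Lagrangian solution, of class `C^∞` on `[0, ∞) × ℝ⁶`, of the relativistic
Vlasov system with kernel `𝒦`, coupling constants `σE`, `σB` and initial datum `g`.
Only the values `f t` for `t ≥ 0` matter. -/
structure IsSmoothLagrangianSolution (𝒦 : Space → Space) (σE σB : ℝ) (g : Phase → ℝ)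
    (f : ℝ → Phase → ℝ) : Prop where
  smooth : ContDiffOn ℝ ∞ (fun p : ℝ × Phase => f p.1 p.2) (Ici 0 ×ˢ univ)
  nonneg : ∀ t, 0 ≤ t → ∀ z, 0 ≤ f t z
  /-- `f_t ∈ L¹(ℝ⁶)`, and the integrals that define `ρ_t(x)` and `J_t(x)` converge. -/
  integrable : ∀ t, 0 ≤ t → Integrable (f t)
  integrable_velocity : ∀ t, 0 ≤ t → ∀ x : Space, Integrable fun v : Space => f t (x, v)
  /-- `∂_t f + v̂ · ∇_x f + (E + v̂ × B) · ∇_v f = 0` at every point of `(0, ∞) × ℝ³ × ℝ³`. -/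
  vlasov : ∀ t, 0 < t → ∀ x v : Space,
    deriv (fun τ => f τ (x, v)) t
      + fderiv ℝ (fun y => f t (y, v)) x (relVelocity v)
      + fderiv ℝ (fun w => f t (x, w)) v (acceleration 𝒦 σE σB (f t) x v) = 0
  initial : ∀ z, f 0 z = g z
  /-- `f` is Lagrangian for its own vector field on every bounded time interval. -/
  lagrangian : ∀ T, 0 < T → IsLagrangianSolution (vlasovField 𝒦 σE σB f) T f

end RelativisticVlasov

end

open RelativisticVlasov

/-! The solution is built by characteristics: `f_t = g ∘ S 0 t`, where `S` is the flow of the field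
that `f` itself generates. The mollified kernel is smooth, bounded and Lipschitz, so the
acceleration is an average against `f_t` of a smooth bounded Lipschitz pair interaction
(`acceleration_eq_integral`).

Existence. Label the particles by the points of the compact set `tsupport g`. A configuration `Z ∈
C(tsupport g, ℝ⁶)` together with one test particle obeys an autonomous equation in a Banach space,
with a smooth bounded Lipschitz right-hand side. The global flow is smooth by the implicit function
theorem (`IsFlow.contDiff`), and its test-particle component is the evolution `S`
(`exists_meanField_flow`, `exists_selfConsistent_evolution`). The field is divergence free, so `S`
preserves volume (`IsSmoothEvolution.measurePreserving`). A change of variables then shows that the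
transported density generates exactly the field which moves it (`vlasovField_transported`), and the
image of `g ℒ⁶` under `z ↦ S · 0 z` is the required measure on curves.

Uniqueness. Let `f` be any smooth Lagrangian solution, with flow `X` and path measure `Λ`. The
marginals of `Λ` all have the same mass, so the field of `f` is bounded and almost every trajectory
of `X` from time `0` lives until `T` (`IsMaximalRegularFlow.ae_global`). Hence `f_t ℒ⁶` is the image
of `g ℒ⁶` under `X t 0` (`IsTransported.marginal_eq_map`), and `X` solves the same mean-field
equation as `S`, almost everywhere. A Gronwall-type iteration gives `X t 0 = S t 0` almost
everywhere (`meanField_trajectories_unique`), so the two densities agree almost everywhere, and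
everywhere by continuity. -/

noncomputable section

namespace RelativisticVlasov

/-! ### Superposition operators -/

section Superposition

variable {K : Type} [TopologicalSpace K] [CompactSpace K]
variable {E : Type} [NormedAddCommGroup E] [NormedSpace ℝ E]
variable {F : Type} [NormedAddCommGroup F] [NormedSpace ℝ F]

/-- The superposition operator `u ↦ φ ∘ u` on continuous functions. -/
def superpose (φ : E → F) (hφ : Continuous φ) (u : C(K, E)) : C(K, F) :=
  (⟨φ, hφ⟩ : C(E, F)).comp u

/-- Pointwise application of a continuous family of operators. -/
def pointwiseApply : C(K, E →L[ℝ] F) →L[ℝ] C(K, E) →L[ℝ] C(K, F) :=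
  LinearMap.mkContinuous₂
    (LinearMap.mk₂ ℝ (fun (A : C(K, E →L[ℝ] F)) (h : C(K, E)) => (⟨fun k => A k (h k), by fun_prop⟩ : C(K, F)))
      (fun _ _ _ => by ext; simp) (fun _ _ _ => by ext; simp) (fun _ _ _ => by ext; simp)
      (fun _ _ _ => by ext; simp)) 1
    (fun A h => by
      rw [one_mul, ContinuousMap.norm_le _ (by positivity)]
      intro k
      exact ((A k).le_opNorm _).trans
        (mul_le_mul (A.norm_coe_le_norm k) (h.norm_coe_le_norm k) (norm_nonneg _) (norm_nonneg A)))

@[simp] lemma pointwiseApply_apply (A : C(K, E →L[ℝ] F)) (h : C(K, E)) (k : K) :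
    pointwiseApply A h k = A k (h k) := rfl

/-- The mean value inequality on the segment from `u k` to `u k + h k` bounds the remainder at each
`k`. The bound is uniform in `k` because `u ↦ φ' ∘ u` is continuous for the sup norm, which rests on
compactness of `K` and not on uniform continuity of `φ'`. -/
lemma hasFDerivAt_superpose (φ : E → F) (φ' : E → E →L[ℝ] F)
    (hφ : ∀ x, HasFDerivAt φ (φ' x) x) (hc : Continuous φ) (hc' : Continuous φ') (u : C(K, E)) :
    HasFDerivAt (superpose φ hc : C(K, E) → C(K, F)) (pointwiseApply (superpose φ' hc' u)) u := by
  rw [hasFDerivAt_iff_isLittleO_nhds_zero, Asymptotics.isLittleO_iff]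
  intro ε hε
  have hcont : Continuous (superpose φ' hc' : C(K, E) → C(K, E →L[ℝ] F)) :=
    ContinuousMap.continuous_postcomp _
  obtain ⟨δ, hδ, H⟩ := Metric.continuousAt_iff.1 (hcont.continuousAt (x := u)) ε hε
  filter_upwards [Metric.ball_mem_nhds (0 : C(K, E)) hδ] with h hh
  rw [mem_ball_zero_iff] at hh
  rw [ContinuousMap.norm_le _ (by positivity)]
  intro k
  have key : ∀ x ∈ segment ℝ (u k) (u k + h k), ‖φ' x - φ' (u k)‖ ≤ ε := by
    intro x hx
    rw [segment_eq_image'] at hx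
    obtain ⟨θ, ⟨h0, h1⟩, rfl⟩ := hx
    have h2 : dist (u + θ • h) u < δ := by
      rw [dist_eq_norm, add_sub_cancel_left, norm_smul, Real.norm_of_nonneg h0]
      exact (mul_le_of_le_one_left (norm_nonneg _) h1).trans_lt hh
    have h3 := (ContinuousMap.dist_lt_iff hε).1 (H h2) k
    rw [dist_eq_norm] at h3
    simpa [superpose] using h3.le
  have h4 := (convex_segment (u k) (u k + h k)).norm_image_sub_le_of_norm_hasFDerivWithin_le'
    (fun x _ => (hφ x).hasFDerivWithinAt) key (left_mem_segment ℝ _ _) (right_mem_segment ℝ _ _)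
  simp only [add_sub_cancel_left] at h4
  refine le_trans ?_ (h4.trans (mul_le_mul_of_nonneg_left (h.norm_coe_le_norm k) hε.le))
  simp [superpose]

/-- The derivative is again a superposition operator, followed by a bounded linear map. The target
space is quantified inside the induction because `fderiv ℝ φ` takes values in `E →L[ℝ] F`. -/
lemma contDiff_superpose_nat (n : ℕ) : ∀ {F : Type} [NormedAddCommGroup F] [NormedSpace ℝ F]
    (φ : E → F) (_ : ContDiff ℝ n φ) (hc : Continuous φ),
    ContDiff ℝ n (superpose φ hc : C(K, E) → C(K, F)) := by
  induction n with
  | zero =>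
    intro F _ _ φ hφ hc
    exact contDiff_zero.2 (ContinuousMap.continuous_postcomp _)
  | succ n ih =>
    intro F _ _ φ hφ hc
    have hφ' : ContDiff ℝ ((n : WithTop ℕ∞) + 1) φ := by exact_mod_cast hφ
    have h1 := contDiff_succ_iff_fderiv.1 hφ'
    have hd : ∀ u : C(K, E), HasFDerivAt (superpose φ hc : C(K, E) → C(K, F))
        (pointwiseApply (superpose (fderiv ℝ φ) h1.2.2.continuous u)) u := fun u =>
      hasFDerivAt_superpose φ (fderiv ℝ φ) (fun x => (h1.1 x).hasFDerivAt) hc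
        h1.2.2.continuous u
    have : ContDiff ℝ ((n : WithTop ℕ∞) + 1) (superpose φ hc : C(K, E) → C(K, F)) := by
      rw [contDiff_succ_iff_fderiv]
      refine ⟨fun u => (hd u).differentiableAt, by simp, ?_⟩
      have : fderiv ℝ (superpose φ hc : C(K, E) → C(K, F)) =
          fun u => pointwiseApply (superpose (fderiv ℝ φ) h1.2.2.continuous u) :=
        funext fun u => (hd u).fderiv
      rw [this]
      exact pointwiseApply.contDiff.comp (ih _ h1.2.2 _)
    exact_mod_cast this

lemma contDiff_superpose (φ : E → F) (hφ : ContDiff ℝ ∞ φ) :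
    ContDiff ℝ ∞ (superpose φ hφ.continuous : C(K, E) → C(K, F)) :=
  contDiff_infty.2 fun n => contDiff_superpose_nat n φ (contDiff_infty.1 hφ n) _

end Superposition

/-! ### The flow of a smooth vector field -/

section Flow

variable {Y : Type} [NormedAddCommGroup Y] [NormedSpace ℝ Y]

/-- Since `G` is bounded by `M`, a solution on a time interval of radius `n + 1` stays in the ball
of radius `M (n + 1)`, so Picard–Lindelöf applies on each such interval. Uniqueness glues the
pieces. -/
lemma exists_global_solution [CompleteSpace Y] (G : Y → Y) {L M : ℝ≥0} (hL : LipschitzWith L G)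
    (hM : ∀ y, ‖G y‖ ≤ M) (y : Y) :
    ∃ α : ℝ → Y, α 0 = y ∧ ∀ t, HasDerivAt α (G (α t)) t := by
  have loc : ∀ n : ℕ, ∃ α : ℝ → Y, α 0 = y ∧
      ∀ t ∈ Ioo (-(n + 1 : ℝ)) (n + 1), HasDerivAt α (G (α t)) t := by
    intro n
    have h0 : (0 : ℝ) ∈ Icc (-(n + 1 : ℝ)) (n + 1) := ⟨by linarith [n.cast_nonneg (α := ℝ)], by positivity⟩
    have hp : IsPicardLindelof (fun _ => G) (⟨0, h0⟩ : Icc (-(n + 1 : ℝ)) (n + 1)) y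
        (M * (n + 1)) 0 M L :=
      { lipschitzOnWith := fun _ _ => hL.lipschitzOnWith
        continuousOn := fun _ _ => continuousOn_const
        norm_le := fun _ _ x _ => hM x
        mul_max_le := by simp }
    obtain ⟨α, h1, h2⟩ := hp.exists_eq_forall_mem_Icc_hasDerivWithinAt₀
    exact ⟨α, h1, fun t ht => (h2 t (Ioo_subset_Icc_self ht)).hasDerivAt (Icc_mem_nhds ht.1 ht.2)⟩
  choose α h0 hd using loc
  have agree : ∀ m n : ℕ, m ≤ n → EqOn (α m) (α n) (Ioo (-(m + 1 : ℝ)) (m + 1)) := by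
    intro m n hmn
    have hmn' : (m : ℝ) ≤ n := by exact_mod_cast hmn
    refine ODE_solution_unique_of_mem_Ioo (v := fun _ => G) (s := fun _ => univ) (K := L)
      (t₀ := 0) (fun _ _ => hL.lipschitzOnWith)
      ⟨by linarith [m.cast_nonneg (α := ℝ)], by positivity⟩
      (fun t ht => ⟨hd m t ht, trivial⟩)
      (fun t ht => ⟨hd n t ⟨by linarith [ht.1], by linarith [ht.2]⟩, trivial⟩) (by rw [h0, h0])
  let N : ℝ → ℕ := fun t => ⌈|t|⌉₊
  have hN : ∀ t, t ∈ Ioo (-(N t + 1 : ℝ)) (N t + 1) := fun t => by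
    have := Nat.le_ceil |t|
    have h1 := neg_abs_le t
    have h2 := le_abs_self t
    constructor <;> simp only [N] <;> linarith
  refine ⟨fun t => α (N t) t, h0 _, fun t => ?_⟩
  refine (hd (N t) t (hN t)).congr_of_eventuallyEq ?_
  filter_upwards [Ioo_mem_nhds (hN t).1 (hN t).2] with s hs
  rcases le_total (N s) (N t) with h | h
  · exact agree _ _ h (hN s)
  · exact (agree _ _ h hs).symm

/-- The global flow of a bounded Lipschitz vector field. -/
structure IsFlow (G : Y → Y) (Φ : ℝ → Y → Y) : Prop where
  zero : ∀ y, Φ 0 y = y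
  hasDerivAt : ∀ t y, HasDerivAt (fun τ => Φ τ y) (G (Φ t y)) t

lemma exists_isFlow [CompleteSpace Y] (G : Y → Y) {L M : ℝ≥0} (hL : LipschitzWith L G)
    (hM : ∀ y, ‖G y‖ ≤ M) : ∃ Φ : ℝ → Y → Y, IsFlow G Φ := by
  choose Φ h0 hd using exists_global_solution G hL hM
  exact ⟨fun t y => Φ y t, h0, fun t y => hd y t⟩

lemma IsFlow.eq_of_hasDerivAt {G : Y → Y} {Φ : ℝ → Y → Y} (h : IsFlow G Φ) {L : ℝ≥0}
    (hL : LipschitzWith L G) {α : ℝ → Y} (hα : ∀ t, HasDerivAt α (G (α t)) t) (t : ℝ) :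
    Φ t (α 0) = α t :=
  congr_fun (ODE_solution_unique_univ (v := fun _ => G) (s := fun _ => univ) (K := L) (t₀ := 0)
    (f := fun τ => Φ τ (α 0)) (fun _ => hL.lipschitzOnWith)
    (fun t => ⟨h.hasDerivAt t _, trivial⟩) (fun t => ⟨hα t, trivial⟩) (h.zero _)) t

lemma IsFlow.add {G : Y → Y} {Φ : ℝ → Y → Y} (h : IsFlow G Φ) {L : ℝ≥0}
    (hL : LipschitzWith L G) (t s : ℝ) (y : Y) : Φ (t + s) y = Φ t (Φ s y) := by
  have := h.eq_of_hasDerivAt hL (α := fun τ => Φ (τ + s) y)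
    (fun τ => (h.hasDerivAt (τ + s) y).comp_add_const τ s) t
  simpa using this.symm

/-- The flow is `M`-Lipschitz in time uniformly in `y`, and Lipschitz in `y` at each fixed time by
Gronwall; negative times are the forward flow of `-G`. Together these give joint continuity. -/
lemma IsFlow.continuous {G : Y → Y} {Φ : ℝ → Y → Y} (h : IsFlow G Φ) {L M : ℝ≥0}
    (hL : LipschitzWith L G) (hM : ∀ y, ‖G y‖ ≤ M) : Continuous (fun p : ℝ × Y => Φ p.1 p.2) := by
  have ht : ∀ y, LipschitzWith M (fun t => Φ t y) := fun y =>
    lipschitzWith_of_nnnorm_deriv_le (fun t => (h.hasDerivAt t y).differentiableAt)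
      (fun t => by rw [(h.hasDerivAt t y).deriv]; exact hM _)
  have fwd : ∀ (G : Y → Y) (Φ : ℝ → Y → Y), IsFlow G Φ → LipschitzWith L G → ∀ t ≥ 0, ∀ y y',
      dist (Φ t y) (Φ t y') ≤ dist y y' * Real.exp (L * t) := by
    intro G Φ h hL t ht y y'
    have := dist_le_of_trajectories_ODE (v := fun _ => G) (K := L) (f := fun t => Φ t y)
      (g := fun t => Φ t y') (a := 0) (b := t) (δ := dist y y') (fun _ => hL)
      (fun s _ => (h.hasDerivAt s y).continuousAt.continuousWithinAt)
      (fun s _ => (h.hasDerivAt s y).hasDerivWithinAt)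
      (fun s _ => (h.hasDerivAt s y').continuousAt.continuousWithinAt)
      (fun s _ => (h.hasDerivAt s y').hasDerivWithinAt) (by simp [h.zero]) t ⟨ht, le_rfl⟩
    simpa using this
  have hy : ∀ t, Continuous (Φ t) := by
    intro t
    rcases le_total 0 t with h0 | h0
    · refine (LipschitzWith.of_dist_le_mul (K := Real.toNNReal (Real.exp (L * t)))
        fun y y' => ?_).continuous
      rw [Real.coe_toNNReal _ (Real.exp_pos _).le, mul_comm]
      exact fwd G Φ h hL t h0 y y'
    · have hn : IsFlow (fun y => -G y) (fun s y => Φ (-s) y) :=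
        ⟨by simpa using h.zero, fun s y => by
          simpa [Function.comp_def] using (h.hasDerivAt (-s) y).scomp s (hasDerivAt_neg s)⟩
      refine (LipschitzWith.of_dist_le_mul (K := Real.toNNReal (Real.exp (L * -t)))
        fun y y' => ?_).continuous
      rw [Real.coe_toNNReal _ (Real.exp_pos _).le, mul_comm]
      simpa using fwd _ _ hn hL.neg (-t) (by linarith) y y'
  exact continuous_prod_of_continuous_lipschitzWith (fun p : ℝ × Y => Φ p.1 p.2) M hy ht

/-! ### Smooth dependence of the flow on time and starting point -/

/-- Continuous curves in `Y` parametrized by the unit interval. -/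
abbrev UnitCurve (Y : Type) [NormedAddCommGroup Y] : Type := C(Icc (0 : ℝ) 1, Y)

/-- The Volterra operator `u ↦ ∫₀ u` on curves parametrised by `[0, 1]`. -/
def volterra : UnitCurve Y →L[ℝ] UnitCurve Y :=
  LinearMap.mkContinuous
    { toFun := fun u => ⟨fun s => ∫ r in (0 : ℝ)..s, u (projIcc 0 1 zero_le_one r), by
        have : Continuous fun s : ℝ => ∫ r in (0 : ℝ)..s, u (projIcc 0 1 zero_le_one r) :=
          intervalIntegral.continuous_primitive
            (fun _ _ => (u.continuous.comp continuous_projIcc).intervalIntegrable _ _) 0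
        fun_prop⟩
      map_add' := fun u w => by
        ext s
        simpa using intervalIntegral.integral_add
          ((u.continuous.comp continuous_projIcc).intervalIntegrable (μ := volume) 0 s)
          ((w.continuous.comp continuous_projIcc).intervalIntegrable 0 s)
      map_smul' := fun c u => by
        ext s
        simp } 1
    (fun u => by
      rw [one_mul, ContinuousMap.norm_le _ (by positivity)]
      rintro ⟨s, h0, h1⟩
      refine (intervalIntegral.norm_integral_le_of_norm_le_const
        (fun r _ => u.norm_coe_le_norm _)).trans ?_
      rw [sub_zero, abs_of_nonneg h0]
      exact mul_le_of_le_one_right (norm_nonneg _) h1)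

lemma volterra_apply (u : UnitCurve Y) (s : Icc (0 : ℝ) 1) :
    volterra u s = ∫ r in (0 : ℝ)..s, u (projIcc 0 1 zero_le_one r) := rfl

lemma norm_volterra_le : ‖(volterra : UnitCurve Y →L[ℝ] UnitCurve Y)‖ ≤ 1 :=
  LinearMap.mkContinuous_norm_le _ zero_le_one _

/-- After rescaling time to `[0, 1]`, the curve `s ↦ Φ (t s) y` is a zero `u` of `H = u - y - t ∫₀
G(u)`, where `t` and `y` are mere parameters. The partial derivative in `u` is `1 - A` with `‖A‖ ≤
|t| L < 1`, hence invertible by the Neumann series, and the implicit function theorem gives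
smoothness in `(t, y)` at once. -/
lemma IsFlow.contDiffAt_of_small [CompleteSpace Y] {G : Y → Y} {Φ : ℝ → Y → Y} (h : IsFlow G Φ) {L M : ℝ≥0}
    (hL : LipschitzWith L G) (hM : ∀ y, ‖G y‖ ≤ M) (hG : ContDiff ℝ ∞ G)
    {t₀ : ℝ} (ht₀ : |t₀| * L < 1) (y₀ : Y) :
    ContDiffAt ℝ ∞ (fun p : ℝ × Y => Φ p.1 p.2) (t₀, y₀) := by
  let N : UnitCurve Y → UnitCurve Y := superpose G hG.continuous
  have hN : ContDiff ℝ ∞ N := contDiff_superpose G hG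
  let cst : Y →L[ℝ] UnitCurve Y := ContinuousLinearMap.const ℝ (Icc (0 : ℝ) 1)
  let H : (ℝ × Y) × UnitCurve Y → UnitCurve Y := fun q =>
    q.2 - cst q.1.2 - q.1.1 • volterra (N q.2)
  have hH : ContDiff ℝ ∞ H := by
    have h1 : ContDiff ℝ ∞ (fun q : (ℝ × Y) × UnitCurve Y => volterra (N q.2)) :=
      volterra.contDiff.comp (hN.comp contDiff_snd)
    have h2 : ContDiff ℝ ∞ (fun q : (ℝ × Y) × UnitCurve Y => cst q.1.2) :=
      cst.contDiff.comp (contDiff_snd.comp contDiff_fst)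
    exact (contDiff_snd.sub h2).sub ((contDiff_fst.comp contDiff_fst).smul h1)
  have hΦ := h.continuous hL hM
  let U : C(ℝ × Y, UnitCurve Y) := ContinuousMap.curry
    ⟨fun q : (ℝ × Y) × Icc (0 : ℝ) 1 => Φ (q.1.1 * q.2) q.1.2, by fun_prop⟩
  have hU : ∀ p s, U p s = Φ (p.1 * s) p.2 := fun _ _ => rfl
  have hzero : ∀ p, H (p, U p) = 0 := by
    rintro ⟨t, y⟩
    ext s
    have hd : ∀ r : ℝ, HasDerivAt (fun r => Φ (t * r) y) (t • G (Φ (t * r) y)) r := fun r => by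
      simpa [Function.comp_def] using (h.hasDerivAt (t * r) y).scomp r ((hasDerivAt_id r).const_mul t)
    have hc : Continuous fun r => t • G (Φ (t * r) y) := by
      have := hG.continuous
      fun_prop
    have hint := intervalIntegral.integral_eq_sub_of_hasDerivAt (a := 0) (b := s)
      (fun r _ => hd r) (hc.intervalIntegrable _ _)
    have e1 : ∫ r in (0 : ℝ)..s, N (U (t, y)) (projIcc 0 1 zero_le_one r) =
        ∫ r in (0 : ℝ)..s, G (Φ (t * r) y) := by
      refine intervalIntegral.integral_congr fun r hr => ?_
      rw [uIcc_of_le s.2.1] at hr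
      have : (projIcc (0 : ℝ) 1 zero_le_one r : ℝ) = r := by
        rw [projIcc_of_mem _ ⟨hr.1, hr.2.trans s.2.2⟩]
      simp [N, superpose, hU, this]
    rw [intervalIntegral.integral_smul] at hint
    have e2 : H ((t, y), U (t, y)) s = U (t, y) s - y - t • volterra (N (U (t, y))) s := rfl
    rw [e2, volterra_apply, e1, hint, hU]
    simp [h.zero]
  let p₀ : ℝ × Y := (t₀, y₀)
  let A : UnitCurve Y →L[ℝ] UnitCurve Y := t₀ • (volterra ∘L fderiv ℝ N (U p₀))
  have hNL : LipschitzWith L N := by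
    refine LipschitzWith.of_dist_le_mul fun u w => ?_
    rw [ContinuousMap.dist_le (by positivity)]
    intro s
    exact (hL.dist_le_mul _ _).trans
      (mul_le_mul_of_nonneg_left (ContinuousMap.dist_apply_le_dist s) L.2)
  have hA : ‖A‖ < 1 := by
    refine lt_of_le_of_lt ?_ ht₀
    refine (ContinuousLinearMap.opNorm_smul_le _ _).trans ?_
    rw [Real.norm_eq_abs]
    refine mul_le_mul_of_nonneg_left ?_ (abs_nonneg _)
    refine (ContinuousLinearMap.opNorm_comp_le _ _).trans ?_
    calc _ ≤ 1 * (L : ℝ) := mul_le_mul norm_volterra_le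
          (norm_fderiv_le_of_lipschitz ℝ hNL) (norm_nonneg _) zero_le_one
      _ = L := one_mul _
  have hpart : fderiv ℝ H (p₀, U p₀) ∘L .inr ℝ (ℝ × Y) (UnitCurve Y) =
      (1 : UnitCurve Y →L[ℝ] UnitCurve Y) - A := by
    have h1 : HasFDerivAt (fun u => H (p₀, u))
        (fderiv ℝ H (p₀, U p₀) ∘L .inr ℝ (ℝ × Y) (UnitCurve Y)) (U p₀) :=
      ((hH.differentiable (by simp) (p₀, U p₀)).hasFDerivAt).comp (U p₀)
        (hasFDerivAt_prodMk_right p₀ (U p₀))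
    have h2 : HasFDerivAt (fun u => H (p₀, u)) ((1 : UnitCurve Y →L[ℝ] UnitCurve Y) - A) (U p₀) :=
      ((hasFDerivAt_id (U p₀)).sub_const (cst y₀)).sub
        ((volterra.hasFDerivAt.comp (U p₀)
          (hN.differentiable (by simp) (U p₀)).hasFDerivAt).const_smul t₀)
    exact h1.unique h2
  have hinv : (fderiv ℝ H (p₀, U p₀) ∘L .inr ℝ (ℝ × Y) (UnitCurve Y)).IsInvertible := by
    rw [hpart]
    exact ⟨ContinuousLinearEquiv.ofUnit (Units.oneSub A hA), rfl⟩
  have hcd : ContDiffAt ℝ ∞ H (p₀, U p₀) := hH.contDiffAt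
  have hψ := hcd.contDiffAt_implicitFunction (by simp) hinv
  have hev := hcd.eventually_apply_eq_iff_implicitFunction (by simp) hinv
  -- Joint continuity of the flow keeps `U p` in the neighbourhood where the implicit function is
  -- the only zero.
  have hUc : Tendsto (fun p => (p, U p)) (𝓝 p₀) (𝓝 (p₀, U p₀)) :=
    (continuous_id.prodMk U.continuous).continuousAt
  have hev' : (fun p : ℝ × Y => Φ p.1 p.2) =ᶠ[𝓝 p₀]
      fun p => ContinuousMap.evalCLM ℝ (⟨1, by simp⟩ : Icc (0 : ℝ) 1)
        (hcd.implicitFunction (by simp) hinv p) := by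
    filter_upwards [hUc.eventually hev] with p hp
    have := hp.1 ((hzero p).trans (hzero p₀).symm)
    rw [this]
    simp [hU]
  refine ContDiffAt.congr_of_eventuallyEq ?_ hev'
  exact (ContinuousMap.evalCLM ℝ (⟨1, by simp⟩ : Icc (0 : ℝ) 1)).contDiff.contDiffAt.comp _ hψ

/-- The flow of a smooth bounded Lipschitz vector field is smooth in all variables. -/
theorem IsFlow.contDiff [CompleteSpace Y] {G : Y → Y} {Φ : ℝ → Y → Y} (h : IsFlow G Φ) {L M : ℝ≥0}
    (hL : LipschitzWith L G) (hM : ∀ y, ‖G y‖ ≤ M) (hG : ContDiff ℝ ∞ G) :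
    ContDiff ℝ ∞ (fun p : ℝ × Y => Φ p.1 p.2) := by
  -- Doubling of time: `Φ_t = Φ_{t/2} ∘ Φ_{t/2}` extends smoothness from the small times `|t| L < 1`
  -- to all times.
  have key : ∀ n : ℕ, ∀ t : ℝ, |t| * L < 2 ^ n → ∀ y,
      ContDiffAt ℝ ∞ (fun p : ℝ × Y => Φ p.1 p.2) (t, y) := by
    intro n
    induction n with
    | zero => exact fun t ht y => h.contDiffAt_of_small hL hM hG (by simpa using ht) y
    | succ n ih =>
      intro t ht y
      have ht' : |t / 2| * L < 2 ^ n := by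
        rw [abs_div, abs_two]
        rw [pow_succ] at ht
        linarith
      have e : (fun p : ℝ × Y => Φ p.1 p.2) =
          (fun p : ℝ × Y => Φ p.1 p.2) ∘ fun p : ℝ × Y => (p.1 / 2, Φ (p.1 / 2) p.2) := by
        ext p
        simp only [Function.comp]
        rw [← h.add hL, add_halves]
      have h1 : ContDiffAt ℝ ∞ (fun p : ℝ × Y => Φ (p.1 / 2) p.2) (t, y) :=
        (ih (t / 2) ht' y).comp (t, y) (f := fun p : ℝ × Y => (p.1 / 2, p.2)) (by fun_prop)
      rw [e]
      exact (ih (t / 2) ht' (Φ (t / 2) y)).comp (t, y)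
        ((contDiffAt_fst.div_const 2).prodMk h1)
  refine contDiff_iff_contDiffAt.2 fun ⟨t, y⟩ => ?_
  obtain ⟨n, hn⟩ := pow_unbounded_of_one_lt (|t| * L) one_lt_two
  exact key n t hn y

end Flow

/-! ### Mean-field systems -/

section MeanField

variable {K : Type} [TopologicalSpace K] [CompactSpace K]
variable {E : Type} [NormedAddCommGroup E] [NormedSpace ℝ E]

lemma lipschitzWith_superpose {K E F : Type} [TopologicalSpace K] [CompactSpace K]
    [NormedAddCommGroup E] [NormedAddCommGroup F] {φ : E → F} {L : ℝ≥0}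
    (hL : LipschitzWith L φ) (hc : Continuous φ) :
    LipschitzWith L (superpose φ hc : C(K, E) → C(K, F)) := by
  refine LipschitzWith.of_dist_le_mul fun u w => ?_
  rw [ContinuousMap.dist_le (by positivity)]
  intro s
  exact (hL.dist_le_mul _ _).trans
    (mul_le_mul_of_nonneg_left (ContinuousMap.dist_apply_le_dist s) L.2)

/-- `(Z, ζ) ↦ (a ↦ (ζ, Z a))`. -/
def pairConst : C(K, E) × E →L[ℝ] C(K, E × E) :=
  LinearMap.mkContinuous
    { toFun := fun p => ⟨fun a => (p.2, p.1 a), by fun_prop⟩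
      map_add' := fun _ _ => rfl
      map_smul' := fun _ _ => rfl } 1
    (fun p => by
      rw [one_mul, ContinuousMap.norm_le _ (by positivity)]
      intro a
      exact max_le (norm_snd_le p) ((p.1.norm_coe_le_norm a).trans (norm_fst_le p)))

/-- `Z ↦ ((a, a') ↦ (Z a, Z a'))`. -/
def pairSelf : C(K, E) →L[ℝ] C(K × K, E × E) :=
  LinearMap.mkContinuous
    { toFun := fun Z => ⟨fun a => (Z a.1, Z a.2), by fun_prop⟩
      map_add' := fun _ _ => rfl
      map_smul' := fun _ _ => rfl } 1
    (fun Z => by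
      rw [one_mul, ContinuousMap.norm_le _ (by positivity)]
      intro a
      exact max_le (Z.norm_coe_le_norm _) (Z.norm_coe_le_norm _))

/-- Application of a functional in the second variable. -/
def partialApply (I : C(K, E) →L[ℝ] E) : C(K × K, E) →L[ℝ] C(K, E) :=
  LinearMap.mkContinuous
    { toFun := fun w => ⟨fun a => I (w.curry a), I.continuous.comp w.curry.continuous⟩
      map_add' := fun u w => by
        ext a
        exact I.map_add (u.curry a) (w.curry a)
      map_smul' := fun c w => by
        ext a
        exact I.map_smul c (w.curry a) } ‖I‖
    (fun w => by
      rw [ContinuousMap.norm_le _ (by positivity)]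
      intro a
      refine I.le_opNorm_of_le ?_
      rw [ContinuousMap.norm_le _ (by positivity)]
      exact fun b => w.norm_coe_le_norm (a, b))

/-- The mean field at the point `ζ` when the particles `a ∈ K` occupy the positions `Z a`. -/
def meanField (β : E → E) {k : E × E → E} (hk : Continuous k) (I : C(K, E) →L[ℝ] E)
    (p : C(K, E) × E) : E :=
  β p.2 + I (superpose k hk (pairConst p))

/-- The mean field felt by the particles themselves. -/
def particleField {β : E → E} (hβ : Continuous β) {k : E × E → E} (hk : Continuous k)
    (I : C(K, E) →L[ℝ] E) (Z : C(K, E)) : C(K, E) :=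
  superpose β hβ Z + partialApply I (superpose k hk (pairSelf Z))

lemma particleField_apply {β : E → E} (hβ : Continuous β) {k : E × E → E} (hk : Continuous k)
    (I : C(K, E) →L[ℝ] E) (Z : C(K, E)) (a : K) :
    particleField hβ hk I Z a = meanField β hk I (Z, Z a) := rfl

lemma contDiff_meanField {β : E → E} (hβ : ContDiff ℝ ∞ β) {k : E × E → E} (hk : ContDiff ℝ ∞ k)
    (I : C(K, E) →L[ℝ] E) : ContDiff ℝ ∞ (meanField β hk.continuous I) :=
  (hβ.comp contDiff_snd).add
    (I.contDiff.comp ((contDiff_superpose k hk).comp (pairConst : C(K, E) × E →L[ℝ] C(K, E × E)).contDiff))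

lemma contDiff_particleField {β : E → E} (hβ : ContDiff ℝ ∞ β) {k : E × E → E}
    (hk : ContDiff ℝ ∞ k) (I : C(K, E) →L[ℝ] E) :
    ContDiff ℝ ∞ (particleField hβ.continuous hk.continuous I) :=
  (contDiff_superpose β hβ).add
    ((partialApply I).contDiff.comp ((contDiff_superpose k hk).comp (pairSelf : C(K, E) →L[ℝ] C(K × K, E × E)).contDiff))

lemma exists_lipschitzWith_meanField {β : E → E} {k : E × E → E} (hk : Continuous k)
    (I : C(K, E) →L[ℝ] E) {Lβ Lk : ℝ≥0} (hLβ : LipschitzWith Lβ β) (hLk : LipschitzWith Lk k) :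
    ∃ L, LipschitzWith L (meanField β hk I) :=
  ⟨_, (hLβ.comp LipschitzWith.prod_snd).add
    (I.lipschitz.comp ((lipschitzWith_superpose hLk hk).comp (pairConst : C(K, E) × E →L[ℝ] C(K, E × E)).lipschitz))⟩

lemma lipschitzWith_particleField {β : E → E} (hβ : Continuous β) {k : E × E → E}
    (hk : Continuous k) (I : C(K, E) →L[ℝ] E) {L : ℝ≥0} (hL : LipschitzWith L (meanField β hk I)) :
    LipschitzWith L (particleField hβ hk I) := by
  refine LipschitzWith.of_dist_le_mul fun Z W => ?_
  rw [ContinuousMap.dist_le (by positivity)]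
  intro a
  simp only [particleField_apply]
  refine (hL.dist_le_mul _ _).trans (mul_le_mul_of_nonneg_left ?_ L.2)
  exact max_le le_rfl (ContinuousMap.dist_apply_le_dist a)

lemma norm_meanField_le {β : E → E} {k : E × E → E} (hk : Continuous k)
    (I : C(K, E) →L[ℝ] E) {Mβ Mk : ℝ≥0} (hMβ : ∀ ζ, ‖β ζ‖ ≤ Mβ) (hMk : ∀ p, ‖k p‖ ≤ Mk)
    (p : C(K, E) × E) : ‖meanField β hk I p‖ ≤ (Mβ + ‖I‖₊ * Mk : ℝ≥0) := by
  refine (norm_add_le _ _).trans ?_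
  push_cast
  exact add_le_add (hMβ _)
    (I.le_opNorm_of_le ((ContinuousMap.norm_le _ Mk.2).2 fun a => hMk _))

/-- A smooth mean-field system with bounded Lipschitz interaction has a global smooth solution.
Here `Z t` is the configuration of the particles at time `t`, and `S t s` is the evolution of test
particles in the mean field between the times `s` and `t`. -/
theorem exists_meanField_flow [CompleteSpace E] {β : E → E} (hβ : ContDiff ℝ ∞ β)
    {k : E × E → E} (hk : ContDiff ℝ ∞ k) (I : C(K, E) →L[ℝ] E)
    {Lβ Lk Mβ Mk : ℝ≥0} (hLβ : LipschitzWith Lβ β) (hLk : LipschitzWith Lk k)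
    (hMβ : ∀ ζ, ‖β ζ‖ ≤ Mβ) (hMk : ∀ p, ‖k p‖ ≤ Mk) (Z₀ : C(K, E)) :
    ∃ (Z : ℝ → C(K, E)) (S : ℝ → ℝ → E → E),
      ContDiff ℝ ∞ (fun p : ℝ × ℝ × E => S p.1 p.2.1 p.2.2) ∧
      ContDiff ℝ ∞ (fun p : ℝ × E => meanField β hk.continuous I (Z p.1, p.2)) ∧
      (∀ s ζ, S s s ζ = ζ) ∧
      (∀ t s ζ, HasDerivAt (fun τ => S τ s ζ) (meanField β hk.continuous I (Z t, S t s ζ)) t) ∧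
      (∀ t s r ζ, S t s (S s r ζ) = S t r ζ) ∧
      (∀ t a, Z t a = S t 0 (Z₀ a)) := by
  obtain ⟨L, hL⟩ := exists_lipschitzWith_meanField hk.continuous I hLβ hLk
  set A := meanField β hk.continuous I with hA
  set F := particleField hβ.continuous hk.continuous I with hF
  have hFL : LipschitzWith L F := lipschitzWith_particleField _ _ I hL
  let G : C(K, E) × E → C(K, E) × E := fun p => (F p.1, A p)
  have hGL : LipschitzWith (max (L * 1) L) G := (hFL.comp LipschitzWith.prod_fst).prodMk hL
  have hAM := norm_meanField_le hk.continuous I hMβ hMk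
  have hGM : ∀ p, ‖G p‖ ≤ (Mβ + ‖I‖₊ * Mk : ℝ≥0) := by
    intro p
    refine max_le ?_ (hAM p)
    rw [ContinuousMap.norm_le _ (NNReal.coe_nonneg _)]
    exact fun a => hAM (p.1, p.1 a)
  have hGC : ContDiff ℝ ∞ G :=
    ((contDiff_particleField hβ hk I).comp contDiff_fst).prodMk (contDiff_meanField hβ hk I)
  obtain ⟨Φ, hΦ⟩ := exists_isFlow G hGL hGM
  have hΦC := hΦ.contDiff hGL hGM hGC
  have hfst : ∀ t p, HasDerivAt (fun τ => (Φ τ p).1) (F (Φ t p).1) t := fun t p =>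
    (ContinuousLinearMap.fst ℝ C(K, E) E).hasFDerivAt.comp_hasDerivAt t (hΦ.hasDerivAt t p)
  have hsnd : ∀ t p, HasDerivAt (fun τ => (Φ τ p).2) (A (Φ t p)) t := fun t p =>
    (ContinuousLinearMap.snd ℝ C(K, E) E).hasFDerivAt.comp_hasDerivAt t (hΦ.hasDerivAt t p)
  -- The configuration solves a closed equation: the test particle does not act on it.
  have indep : ∀ t W ζ ζ', (Φ t (W, ζ)).1 = (Φ t (W, ζ')).1 := fun t W ζ ζ' =>
    congr_fun (ODE_solution_unique_univ (v := fun _ => F) (s := fun _ => univ) (K := L) (t₀ := 0)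
      (f := fun τ => (Φ τ (W, ζ)).1) (g := fun τ => (Φ τ (W, ζ')).1)
      (fun _ => hFL.lipschitzOnWith) (fun t => ⟨hfst t _, trivial⟩)
      (fun t => ⟨hfst t _, trivial⟩) (by rw [hΦ.zero, hΦ.zero])) t
  let Z : ℝ → C(K, E) := fun t => (Φ t (Z₀, 0)).1
  have hZ : ∀ t s ζ, (Φ t (Z s, ζ)).1 = Z (t + s) := fun t s ζ => by
    rw [indep t (Z s) ζ (Φ s (Z₀, 0)).2]
    change (Φ t (Φ s (Z₀, 0))).1 = _
    rw [← hΦ.add hGL]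
  have hZC : ContDiff ℝ ∞ Z :=
    contDiff_fst.comp (hΦC.comp (contDiff_id.prodMk contDiff_const))
  have hZd : ∀ t, HasDerivAt Z (F (Z t)) t := fun t => hfst t _
  have hZ0 : Z 0 = Z₀ := by simp [Z, hΦ.zero]
  -- The coupled system is autonomous, so the test evolution from `s` to `t` restarts it from the
  -- configuration `Z s` for the duration `t - s`.
  refine ⟨Z, fun t s ζ => (Φ (t - s) (Z s, ζ)).2, ?_, ?_, ?_, ?_, ?_, ?_⟩
  · refine contDiff_snd.comp (hΦC.comp
      ((contDiff_fst.sub (contDiff_fst.comp contDiff_snd)).prodMk ?_))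
    exact (hZC.comp (contDiff_fst.comp contDiff_snd)).prodMk (contDiff_snd.comp contDiff_snd)
  · exact (contDiff_meanField hβ hk I).comp ((hZC.comp contDiff_fst).prodMk contDiff_snd)
  · intro s ζ
    simp [hΦ.zero]
  · intro t s ζ
    have h1 := (hsnd (t - s) (Z s, ζ)).comp_sub_const t s
    have h2 : Φ (t - s) (Z s, ζ) = (Z t, (Φ (t - s) (Z s, ζ)).2) := by
      ext1
      · rw [hZ, sub_add_cancel]
      · rfl
    rwa [h2] at h1
  · intro t s r ζ
    have h2 : (Z s, (Φ (s - r) (Z r, ζ)).2) = Φ (s - r) (Z r, ζ) := by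
      ext1
      · rw [hZ, sub_add_cancel]
      · rfl
    simp only
    rw [h2, ← hΦ.add hGL, sub_add_sub_cancel]
  · intro t a
    -- A test particle placed on the particle `a` stays on it, since both feel the same mean field.
    have h1 : ∀ t, HasDerivAt (fun τ => (Z τ, Z τ a)) (G (Z t, Z t a)) t := fun t =>
      (hZd t).prodMk ((ContinuousMap.evalCLM ℝ a : C(K, E) →L[ℝ] E).hasFDerivAt.comp_hasDerivAt t (hZd t))
    have h2 := hΦ.eq_of_hasDerivAt hGL h1 t
    simp only [hZ0] at h2 ⊢
    rw [sub_zero, h2]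

end MeanField

/-! ### The cross product and the relativistic velocity -/

/-- The cross product as a continuous bilinear map. -/
def crossL : Space →L[ℝ] Space →L[ℝ] Space :=
  LinearMap.toContinuousBilinearMap
    (LinearMap.mk₂ ℝ cross
      (fun a b c => by simp [cross]) (fun r a b => by simp [cross])
      (fun a b c => by simp [cross]) (fun r a b => by simp [cross]))

@[simp] lemma crossL_apply (a b : Space) : crossL a b = cross a b := rfl

lemma one_add_norm_sq_pos (v : Space) : 0 < 1 + ‖v‖ ^ 2 := by positivity

lemma contDiff_relVelocity : ContDiff ℝ ∞ relVelocity := by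
  unfold relVelocity
  refine ContDiff.smul (ContDiff.inv (ContDiff.sqrt ?_ fun v => (one_add_norm_sq_pos v).ne')
    fun v => (Real.sqrt_pos.2 (one_add_norm_sq_pos v)).ne') contDiff_id
  exact contDiff_const.add (contDiff_norm_sq ℝ)

lemma norm_relVelocity_le (v : Space) : ‖relVelocity v‖ ≤ 1 := by
  have h := Real.sqrt_pos.2 (one_add_norm_sq_pos v)
  rw [relVelocity, norm_smul, norm_inv, Real.norm_of_nonneg h.le, inv_mul_le_iff₀ h, mul_one]
  exact Real.le_sqrt_of_sq_le (by linarith)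

lemma hasFDerivAt_relVelocity (v : Space) :
    HasFDerivAt relVelocity ((Real.sqrt (1 + ‖v‖ ^ 2))⁻¹ • ContinuousLinearMap.id ℝ Space
      - ((Real.sqrt (1 + ‖v‖ ^ 2))⁻¹ ^ 3 • innerSL ℝ v).smulRight v) v := by
  have hpos := one_add_norm_sq_pos v
  have hs := Real.sqrt_pos.2 hpos
  have h1 : HasFDerivAt (fun v : Space => 1 + ‖v‖ ^ 2) (2 • innerSL ℝ v) v :=
    ((hasStrictFDerivAt_norm_sq v).hasFDerivAt).const_add 1
  have h2 := ((hasDerivAt_inv hs.ne').comp_hasFDerivAt v (h1.sqrt hpos.ne')).smul (hasFDerivAt_id v)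
  refine h2.congr_fderiv ?_
  ext1 w
  simp only [add_apply, smul_apply,
    ContinuousLinearMap.id_apply, ContinuousLinearMap.smulRight_apply,
    sub_apply, id, smul_eq_mul, nsmul_eq_mul]
  rw [sub_eq_add_neg, ← neg_smul]
  congr 2
  push_cast
  field_simp

lemma norm_fderiv_relVelocity_le (v : Space) : ‖fderiv ℝ relVelocity v‖ ≤ 2 := by
  have hpos := one_add_norm_sq_pos v
  have hs := Real.sqrt_pos.2 hpos
  set γ := (Real.sqrt (1 + ‖v‖ ^ 2))⁻¹ with hγ
  have hγ0 : 0 < γ := inv_pos.2 hs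
  have hγ2 : γ ^ 2 * (1 + ‖v‖ ^ 2) = 1 := by
    rw [hγ, inv_pow, Real.sq_sqrt hpos.le, inv_mul_cancel₀ hpos.ne']
  have hγ1 : γ ≤ 1 := by
    rw [hγ]
    exact inv_le_one_of_one_le₀ (Real.one_le_sqrt.2 (by nlinarith [sq_nonneg ‖v‖]))
  rw [(hasFDerivAt_relVelocity v).fderiv]
  refine ContinuousLinearMap.opNorm_le_bound _ zero_le_two fun w => ?_
  rw [← hγ]
  simp only [sub_apply, smul_apply,
    ContinuousLinearMap.id_apply, ContinuousLinearMap.smulRight_apply, innerSL_apply_apply, smul_eq_mul]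
  refine (norm_sub_le _ _).trans ?_
  rw [norm_smul, norm_smul, norm_mul, norm_pow, Real.norm_of_nonneg hγ0.le]
  have h1 : ‖inner ℝ v w‖ ≤ ‖v‖ * ‖w‖ := norm_inner_le_norm v w
  have h2 : γ ^ 3 * ‖inner ℝ v w‖ * ‖v‖ ≤ γ * ‖w‖ := by
    calc γ ^ 3 * ‖inner ℝ v w‖ * ‖v‖ ≤ γ ^ 3 * (‖v‖ * ‖w‖) * ‖v‖ := by gcongr
      _ = γ * ‖w‖ * (γ ^ 2 * ‖v‖ ^ 2) := by ring
      _ ≤ γ * ‖w‖ * 1 := by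
        refine mul_le_mul_of_nonneg_left ?_ (by positivity)
        nlinarith
      _ = _ := mul_one _
  have h3 : γ * ‖w‖ ≤ 1 * ‖w‖ := by gcongr
  linarith

/-! ### Bounded Lipschitz maps -/

/-- Bounded and Lipschitz continuous maps. -/
structure BoundedLipschitz {X F : Type} [PseudoMetricSpace X] [NormedAddCommGroup F]
    (f : X → F) : Prop where
  lipschitz : ∃ L : ℝ≥0, LipschitzWith L f
  bounded : ∃ M : ℝ≥0, ∀ x, ‖f x‖ ≤ M

namespace BoundedLipschitz

variable {X F G H : Type} [PseudoMetricSpace X] [NormedAddCommGroup F] [NormedSpace ℝ F]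
  [NormedAddCommGroup G] [NormedSpace ℝ G] [NormedAddCommGroup H] [NormedSpace ℝ H]

lemma add {X F : Type} [PseudoMetricSpace X] [NormedAddCommGroup F] {f g : X → F} (hf : BoundedLipschitz f) (hg : BoundedLipschitz g) :
    BoundedLipschitz fun x => f x + g x := by
  obtain ⟨⟨L, hL⟩, M, hM⟩ := hf
  obtain ⟨⟨L', hL'⟩, M', hM'⟩ := hg
  exact ⟨⟨_, hL.add hL'⟩, M + M', fun x => (norm_add_le _ _).trans (add_le_add (hM x) (hM' x))⟩

lemma comp {W X F : Type} [PseudoMetricSpace W] [PseudoMetricSpace X] [NormedAddCommGroup F]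
    {f : X → F} (hf : BoundedLipschitz f) {u : W → X}
    {K : ℝ≥0} (hu : LipschitzWith K u) : BoundedLipschitz fun w => f (u w) := by
  obtain ⟨⟨L, hL⟩, M, hM⟩ := hf
  exact ⟨⟨_, hL.comp hu⟩, M, fun w => hM _⟩

lemma clm (T : F →L[ℝ] G) {f : X → F} (hf : BoundedLipschitz f) :
    BoundedLipschitz fun x => T (f x) := by
  obtain ⟨⟨L, hL⟩, M, hM⟩ := hf
  exact ⟨⟨_, T.lipschitz.comp hL⟩, ‖T‖₊ * M, fun x => T.le_opNorm_of_le (hM x)⟩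

lemma bilin (B : F →L[ℝ] G →L[ℝ] H) {f : X → F} {g : X → G} (hf : BoundedLipschitz f)
    (hg : BoundedLipschitz g) : BoundedLipschitz fun x => B (f x) (g x) := by
  obtain ⟨⟨L, hL⟩, M, hM⟩ := hf
  obtain ⟨⟨L', hL'⟩, M', hM'⟩ := hg
  refine ⟨⟨‖B‖₊ * (L * M' + M * L'), LipschitzWith.of_dist_le_mul fun x y => ?_⟩,
    ‖B‖₊ * M * M', fun x => ?_⟩
  · have h1 : B (f x) (g x) - B (f y) (g y) = B (f x - f y) (g x) + B (f y) (g x - g y) := by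
      simp
    rw [dist_eq_norm, h1]
    have h2 := hL.dist_le_mul x y
    have h3 := hL'.dist_le_mul x y
    rw [dist_eq_norm] at h2 h3
    refine (norm_add_le _ _).trans ((add_le_add (B.le_opNorm₂ _ _) (B.le_opNorm₂ _ _)).trans ?_)
    calc ‖B‖ * ‖f x - f y‖ * ‖g x‖ + ‖B‖ * ‖f y‖ * ‖g x - g y‖
        ≤ ‖B‖ * (L * dist x y) * M' + ‖B‖ * M * (L' * dist x y) := by
          gcongr
          · exact hM' x
          · exact hM y
      _ = _ := by push_cast; ring
  · refine (B.le_opNorm₂ _ _).trans ?_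
    push_cast
    gcongr
    · exact hM x
    · exact hM' x

end BoundedLipschitz

lemma boundedLipschitz_relVelocity : BoundedLipschitz relVelocity :=
  ⟨⟨2, lipschitzWith_of_nnnorm_fderiv_le (𝕜 := ℝ)
    (fun v => (hasFDerivAt_relVelocity v).differentiableAt)
    fun v => by exact_mod_cast norm_fderiv_relVelocity_le v⟩,
    1, fun v => by simpa using norm_relVelocity_le v⟩

/-! ### The mollified kernel -/

lemma norm_coulombKernel (x : Space) : ‖coulombKernel x‖ = (4 * Real.pi)⁻¹ * ‖x‖ ^ (-2 : ℝ) := by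
  rw [coulombKernel, norm_smul, norm_mul, norm_inv, norm_inv, norm_pow, norm_norm,
    Real.norm_of_nonneg (by positivity), mul_assoc]
  congr 1
  -- At the origin both sides vanish, because the real power `0 ^ (-2)` is `0`.
  rcases eq_or_ne x 0 with rfl | hx
  · simp
  · have : ‖x‖ ≠ 0 := norm_ne_zero_iff.2 hx
    rw [Real.rpow_neg (norm_nonneg _), Real.rpow_two]
    field_simp

lemma four_pi_inv_le_one : (4 * Real.pi)⁻¹ ≤ 1 :=
  inv_le_one_of_one_le₀ (by linarith [Real.pi_gt_three])

lemma measurable_coulombKernel : Measurable coulombKernel := by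
  unfold coulombKernel
  fun_prop

lemma locallyIntegrable_coulombKernel : LocallyIntegrable coulombKernel := by
  refine locallyIntegrable_of_norm_le_rpow (C := (4 * Real.pi)⁻¹) (α := 2) (by simp) ?_
    (Eventually.of_forall fun x => (norm_coulombKernel x).le)
    measurable_coulombKernel.aestronglyMeasurable
  simp only [finrank_euclideanSpace, Fintype.card_fin]
  norm_num

lemma norm_coulombKernel_le_one {x : Space} (hx : 1 ≤ ‖x‖) : ‖coulombKernel x‖ ≤ 1 := by
  rw [norm_coulombKernel]
  exact mul_le_one₀ four_pi_inv_le_one (by positivity)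
    (Real.rpow_le_one_of_one_le_of_nonpos hx (by norm_num))

/-- Inside the unit ball the kernel is integrable and `φ` is bounded; outside it the kernel is at
most one and `φ` is integrable. The pairing `B` is general so that the bound serves both for `η` and
for its derivative. -/
lemma exists_bound_convolution_coulombKernel {F G : Type} [NormedAddCommGroup F] [NormedSpace ℝ F]
    [NormedAddCommGroup G] [NormedSpace ℝ G] (B : F →L[ℝ] Space →L[ℝ] G) {φ : Space → F}
    (hφ : Continuous φ) (hc : HasCompactSupport φ) :
    ∃ M : ℝ≥0, ∀ x, ‖(φ ⋆[B, volume] coulombKernel) x‖ ≤ M := by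
  obtain ⟨C, hC⟩ := hc.exists_bound_of_continuous hφ
  have hC0 : 0 ≤ C := (norm_nonneg _).trans (hC 0)
  let κ : Space → Space := (Metric.closedBall 0 1).indicator coulombKernel
  have hκ : Integrable κ := (integrable_indicator_iff measurableSet_closedBall).2
    (locallyIntegrable_coulombKernel.integrableOn_isCompact (isCompact_closedBall 0 1))
  have hφi : Integrable φ := hφ.integrable_of_hasCompactSupport hc
  have hbound : ∀ x y, ‖B (φ y) (coulombKernel (x - y))‖ ≤
      ‖B‖ * (C * ‖κ (x - y)‖ + ‖φ y‖) := by
    intro x y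
    refine (B.le_opNorm₂ _ _).trans ?_
    rw [mul_assoc]
    refine mul_le_mul_of_nonneg_left ?_ (norm_nonneg B)
    by_cases h : x - y ∈ Metric.closedBall (0 : Space) 1
    · have : κ (x - y) = coulombKernel (x - y) := indicator_of_mem h _
      rw [this]
      have := mul_le_mul_of_nonneg_right (hC y) (norm_nonneg (coulombKernel (x - y)))
      linarith [norm_nonneg (φ y)]
    · have h1 : 1 ≤ ‖x - y‖ := by
        rw [mem_closedBall_zero_iff, not_le] at h
        exact h.le
      have := mul_le_mul_of_nonneg_left (norm_coulombKernel_le_one h1) (norm_nonneg (φ y))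
      have h2 : 0 ≤ C * ‖κ (x - y)‖ := by positivity
      linarith
  have hκx : ∀ x, Integrable fun y => C * ‖κ (x - y)‖ := fun x =>
    ((hκ.comp_sub_left x).norm).const_mul C
  refine ⟨Real.toNNReal (‖B‖ * (C * (∫ y, ‖κ y‖) + ∫ y, ‖φ y‖)), fun x => ?_⟩
  refine le_trans ?_ (Real.le_coe_toNNReal _)
  refine (norm_integral_le_of_norm_le (((hκx x).add hφi.norm).const_mul ‖B‖)
    (Eventually.of_forall (hbound x))).trans_eq ?_
  simp only [Pi.add_apply]
  rw [integral_const_mul, integral_add (hκx x) hφi.norm, integral_const_mul,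
    integral_sub_left_eq_self (fun y => ‖κ y‖) volume x]

lemma contDiff_mollifiedKernel {η : Space → ℝ} (hη : ContDiff ℝ ∞ η) (hc : HasCompactSupport η) :
    ContDiff ℝ ∞ (mollifiedKernel η) :=
  hc.contDiff_convolution_left _ hη locallyIntegrable_coulombKernel

/-- The derivative of the convolution can be put on `η`, so its bound is another instance of the
preceding estimate. -/
lemma boundedLipschitz_mollifiedKernel {η : Space → ℝ} (hη : ContDiff ℝ ∞ η)
    (hc : HasCompactSupport η) : BoundedLipschitz (mollifiedKernel η) := by
  have hη1 : ContDiff ℝ 1 η := hη.of_le (by exact_mod_cast le_top)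
  refine ⟨?_, exists_bound_convolution_coulombKernel _ hη.continuous hc⟩
  obtain ⟨M, hM⟩ := exists_bound_convolution_coulombKernel
    ((ContinuousLinearMap.lsmul ℝ ℝ : ℝ →L[ℝ] Space →L[ℝ] Space).precompL Space)
    (hη1.continuous_fderiv one_ne_zero) (hc.fderiv ℝ)
  have hd := fun x => hc.hasFDerivAt_convolution_left
    (ContinuousLinearMap.lsmul ℝ ℝ : ℝ →L[ℝ] Space →L[ℝ] Space) hη1
    locallyIntegrable_coulombKernel x
  refine ⟨M, lipschitzWith_of_nnnorm_fderiv_le (𝕜 := ℝ) (fun x => (hd x).differentiableAt)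
    fun x => ?_⟩
  rw [show fderiv ℝ (mollifiedKernel η) x = _ from (hd x).fderiv]
  exact_mod_cast hM x

/-! ### The pair interaction -/

/-- The acceleration at the first phase point due to a unit mass at the second one. -/
def interaction (𝒦 : Space → Space) (σE σB : ℝ) (p : Phase × Phase) : Space :=
  σE • 𝒦 (p.1.1 - p.2.1) +
    σB • crossL (relVelocity p.1.2) (crossL (relVelocity p.2.2) (𝒦 (p.1.1 - p.2.1)))

lemma contDiff_interaction {𝒦 : Space → Space} (h : ContDiff ℝ ∞ 𝒦) (σE σB : ℝ) :
    ContDiff ℝ ∞ (interaction 𝒦 σE σB) := by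
  have h1 : ContDiff ℝ ∞ fun p : Phase × Phase => 𝒦 (p.1.1 - p.2.1) :=
    h.comp (by fun_prop)
  have h2 : ContDiff ℝ ∞ fun p : Phase × Phase => relVelocity p.1.2 :=
    contDiff_relVelocity.comp (by fun_prop)
  have h3 : ContDiff ℝ ∞ fun p : Phase × Phase => relVelocity p.2.2 :=
    contDiff_relVelocity.comp (by fun_prop)
  unfold interaction
  fun_prop

lemma boundedLipschitz_interaction {𝒦 : Space → Space} (h : BoundedLipschitz 𝒦) (σE σB : ℝ) :
    BoundedLipschitz (interaction 𝒦 σE σB) := by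
  have h1 : BoundedLipschitz fun p : Phase × Phase => 𝒦 (p.1.1 - p.2.1) :=
    h.comp ((LipschitzWith.prod_fst.comp LipschitzWith.prod_fst).sub
      (LipschitzWith.prod_fst.comp LipschitzWith.prod_snd))
  have h2 : BoundedLipschitz fun p : Phase × Phase => relVelocity p.1.2 :=
    boundedLipschitz_relVelocity.comp (LipschitzWith.prod_snd.comp LipschitzWith.prod_fst)
  have h3 : BoundedLipschitz fun p : Phase × Phase => relVelocity p.2.2 :=
    boundedLipschitz_relVelocity.comp (LipschitzWith.prod_snd.comp LipschitzWith.prod_snd)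
  exact (h1.clm (σE • ContinuousLinearMap.id ℝ Space)).add
    ((BoundedLipschitz.bilin crossL h2 (BoundedLipschitz.bilin crossL h3 h1)).clm
      (σB • ContinuousLinearMap.id ℝ Space))

/-- Fubini merges the velocity and space integrals, which makes the acceleration a mean of pair
interactions. -/
lemma acceleration_eq_integral {𝒦 : Space → Space} (hc : Continuous 𝒦) (hb : BoundedLipschitz 𝒦)
    (σE σB : ℝ) {h : Phase → ℝ} (hh : Integrable h) (x v : Space) :
    acceleration 𝒦 σE σB h x v = ∫ z, h z • interaction 𝒦 σE σB ((x, v), z) := by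
  obtain ⟨M, hM⟩ := hb.bounded
  have hvc := contDiff_relVelocity.continuous
  have hK : Integrable fun z : Phase => h z • 𝒦 (x - z.1) :=
    hh.smul_bdd (M : ℝ) (Continuous.aestronglyMeasurable (by fun_prop))
      (Eventually.of_forall fun z => hM _)
  obtain ⟨M', hM'⟩ := (BoundedLipschitz.bilin crossL
    (boundedLipschitz_relVelocity.comp (LipschitzWith.prod_snd (α := Space) (β := Space)))
    (hb.comp (((LipschitzWith.const x).sub (LipschitzWith.prod_fst (α := Space) (β := Space)))))).bounded
  have hB : Integrable fun z : Phase => h z • crossL (relVelocity z.2) (𝒦 (x - z.1)) :=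
    hh.smul_bdd (M' : ℝ) (Continuous.aestronglyMeasurable (by fun_prop))
      (Eventually.of_forall fun z => hM' z)
  have hE : electricField 𝒦 σE h x = σE • ∫ z : Phase, h z • 𝒦 (x - z.1) := by
    rw [electricField, Measure.volume_eq_prod, integral_prod _ hK]
    simp only [chargeDensity, integral_smul_const]
  have hBB : magneticField 𝒦 σB h x =
      σB • ∫ z : Phase, h z • crossL (relVelocity z.2) (𝒦 (x - z.1)) := by
    rw [magneticField, Measure.volume_eq_prod, integral_prod _ hB]
    congr 1
    -- Integrability on phase space gives integrable velocity slices only for almost every `y`,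
    -- which is enough under the integral.
    refine integral_congr_ae ?_
    filter_upwards [Integrable.prod_right_ae (μ := (volume : Measure Space))
      (ν := (volume : Measure Space)) hh] with y hy
    have hi : Integrable fun w : Space => h (y, w) • relVelocity w :=
      hy.smul_bdd 1 hvc.aestronglyMeasurable
        (Eventually.of_forall fun w => norm_relVelocity_le w)
    have := (crossL.flip (𝒦 (x - y))).integral_comp_comm hi
    simp only [ContinuousLinearMap.flip_apply, crossL_apply, map_smul] at this ⊢
    rw [currentDensity, ← this]
  have hBv : Integrable fun z : Phase =>
      h z • crossL (relVelocity v) (crossL (relVelocity z.2) (𝒦 (x - z.1))) := by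
    simpa using (crossL (relVelocity v)).integrable_comp hB
  have e : ∀ z : Phase, h z • interaction 𝒦 σE σB ((x, v), z) =
      σE • (h z • 𝒦 (x - z.1)) +
        σB • (h z • crossL (relVelocity v) (crossL (relVelocity z.2) (𝒦 (x - z.1)))) := fun z => by
    rw [interaction, smul_add, smul_comm, smul_comm (h z) σB]
  simp only [e]
  have hcomm := (crossL (relVelocity v)).integral_comp_comm hB
  have hadd := integral_add (hK.smul σE) (hBv.smul σB)
  simp only [Pi.smul_apply] at hadd
  rw [hadd, integral_smul, integral_smul, acceleration, hE, hBB,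
    ← crossL_apply, map_smul, ← hcomm]
  simp only [map_smul]

/-! ### Liouville's theorem -/

section Liouville

variable {E : Type} [NormedAddCommGroup E] [NormedSpace ℝ E]

/-- `S t s` is the evolution from time `s` to time `t` of the smooth time-dependent vector
field `b`. -/
structure IsSmoothEvolution (b : ℝ → E → E) (S : ℝ → ℝ → E → E) : Prop where
  contDiff : ContDiff ℝ ∞ (fun p : ℝ × ℝ × E => S p.1 p.2.1 p.2.2)
  contDiff_field : ContDiff ℝ ∞ (fun p : ℝ × E => b p.1 p.2)
  self : ∀ s ζ, S s s ζ = ζ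
  hasDerivAt : ∀ t s ζ, HasDerivAt (fun τ => S τ s ζ) (b t (S t s ζ)) t
  trans : ∀ t s r ζ, S t s (S s r ζ) = S t r ζ

namespace IsSmoothEvolution

variable {b : ℝ → E → E} {S : ℝ → ℝ → E → E}

lemma contDiff_space (h : IsSmoothEvolution b S) (t s : ℝ) : ContDiff ℝ ∞ (S t s) :=
  h.contDiff.comp (contDiff_const.prodMk (contDiff_const.prodMk contDiff_id))

lemma contDiff_field_space (h : IsSmoothEvolution b S) (t : ℝ) : ContDiff ℝ ∞ (b t) :=
  h.contDiff_field.comp (contDiff_const.prodMk contDiff_id)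

lemma left_inv (h : IsSmoothEvolution b S) (t s : ℝ) (ζ : E) : S s t (S t s ζ) = ζ := by rw [h.trans, h.self]

/-- The linearised equation: differentiate the ODE in `ζ` and exchange the time and space
derivatives by symmetry of the second derivative. -/
lemma hasDerivAt_fderiv (h : IsSmoothEvolution b S) (t s : ℝ) (ζ : E) :
    HasDerivAt (fun τ => fderiv ℝ (S τ s) ζ)
      (fderiv ℝ (b t) (S t s ζ) ∘L fderiv ℝ (S t s) ζ) t := by
  let H : ℝ × E → E := fun p => S p.1 s p.2
  have hH : ContDiff ℝ ∞ H :=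
    h.contDiff.comp (contDiff_fst.prodMk (contDiff_const.prodMk contDiff_snd))
  have hH1 : ContDiff ℝ ∞ (fderiv ℝ H) := hH.fderiv_right (by simp)
  have hHd := fun p => (hH.differentiable (by simp) p).hasFDerivAt
  have hH1d := fun p => (hH1.differentiable (by simp) p).hasFDerivAt
  have hS : ∀ τ ζ, fderiv ℝ (S τ s) ζ = fderiv ℝ H (τ, ζ) ∘L .inr ℝ ℝ E := fun τ ζ =>
    ((hHd (τ, ζ)).comp ζ (hasFDerivAt_prodMk_right τ ζ)).fderiv
  have ht : ∀ τ ζ, fderiv ℝ H (τ, ζ) (1, 0) = b τ (S τ s ζ) := fun τ ζ => by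
    have h1 : HasDerivAt (fun τ => S τ s ζ) ((fderiv ℝ H (τ, ζ) ∘L .inl ℝ ℝ E) 1) τ :=
      (HasFDerivAt.comp (g := H) (f := fun τ => (τ, ζ)) τ (hHd (τ, ζ)) (hasFDerivAt_prodMk_left τ ζ)).hasDerivAt
    exact h1.unique (h.hasDerivAt τ s ζ)
  have h1 : HasDerivAt (fun τ => fderiv ℝ H (τ, ζ) ∘L .inr ℝ ℝ E)
      ((fderiv ℝ (fderiv ℝ H) (t, ζ) (1, 0)) ∘L .inr ℝ ℝ E) t := by
    have h2 : HasDerivAt (fun τ => fderiv ℝ H (τ, ζ))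
        ((fderiv ℝ (fderiv ℝ H) (t, ζ) ∘L .inl ℝ ℝ E) 1) t :=
      ((hH1d (t, ζ)).comp t (hasFDerivAt_prodMk_left t ζ)).hasDerivAt
    have h3 := (((ContinuousLinearMap.compL ℝ E (ℝ × E) E).flip
      (.inr ℝ ℝ E)).hasFDerivAt (x := fderiv ℝ H (t, ζ))).comp_hasDerivAt t h2
    exact h3
  simp only [hS _ ζ]
  convert! h1 using 1
  rw [← hS]
  ext1 w
  have hsymm : IsSymmSndFDerivAt ℝ H (t, ζ) :=
    hH.contDiffAt.isSymmSndFDerivAt (by simpa using ENat.LEInfty.out)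
  have e1 : fderiv ℝ (fderiv ℝ H) (t, ζ) (1, 0) (0, w) =
      fderiv ℝ (fderiv ℝ H) (t, ζ) (0, w) (1, 0) := hsymm _ _
  have h4 : HasFDerivAt (fun ζ => fderiv ℝ H (t, ζ) (1, 0))
      ((ContinuousLinearMap.apply ℝ E ((1, 0) : ℝ × E)) ∘L
        (fderiv ℝ (fderiv ℝ H) (t, ζ) ∘L .inr ℝ ℝ E)) ζ :=
    (ContinuousLinearMap.apply ℝ E ((1, 0) : ℝ × E)).hasFDerivAt.comp ζ
      ((hH1d (t, ζ)).comp ζ (hasFDerivAt_prodMk_right t ζ))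
  have hb := h.contDiff_field_space t
  have h5 : HasFDerivAt (fun ζ => fderiv ℝ H (t, ζ) (1, 0))
      (fderiv ℝ (b t) (S t s ζ) ∘L fderiv ℝ (S t s) ζ) ζ := by
    simp only [ht]
    exact (hb.differentiable (by simp) _).hasFDerivAt.comp ζ
      ((h.contDiff_space t s).differentiable (by simp) ζ).hasFDerivAt
  have h6 := congrArg (fun T : E →L[ℝ] E => T w) (h5.unique h4)
  simp only [ContinuousLinearMap.comp_apply, ContinuousLinearMap.inr_apply,
    ContinuousLinearMap.apply_apply] at h6 ⊢
  rw [h6, e1]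

end IsSmoothEvolution

/-! ### Jacobi's formula and conservation of volume -/

variable [FiniteDimensional ℝ E]

lemma differentiable_det : Differentiable ℝ (fun A : E →L[ℝ] E => A.det) := by
  let e := Module.finBasis ℝ E
  have h1 : ∀ A : E →L[ℝ] E, A.det =
      ∑ σ : Equiv.Perm (Fin (Module.finrank ℝ E)), (Equiv.Perm.sign σ : ℝ) *
        ∏ i, (e.coord (σ i)).toContinuousLinearMap (A (e i)) := fun A => by
    rw [ContinuousLinearMap.det, ← LinearMap.det_toMatrix e, Matrix.det_apply']
    simp [LinearMap.toMatrix_apply]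
  simp only [h1]
  fun_prop

/-- Jacobi's formula at the identity. The differential of `det` is read off along the line `id + r
A`, where the determinant is a polynomial in `r` with linear coefficient the trace. -/
lemma hasDerivAt_det {W : ℝ → E →L[ℝ] E} {A : E →L[ℝ] E} {t : ℝ} (hW : HasDerivAt W A t)
    (h1 : W t = ContinuousLinearMap.id ℝ E) :
    HasDerivAt (fun τ => (W τ).det) (LinearMap.trace ℝ E A) t := by
  have hd := (differentiable_det (E := E) (ContinuousLinearMap.id ℝ E)).hasFDerivAt
  have hline : HasDerivAt (fun r : ℝ => ContinuousLinearMap.id ℝ E + r • A) A 0 := by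
    simpa using ((hasDerivAt_id (0 : ℝ)).smul_const A).const_add (ContinuousLinearMap.id ℝ E)
  have h2 : HasDerivAt (fun r : ℝ => (ContinuousLinearMap.id ℝ E + r • A).det)
      (fderiv ℝ (fun A : E →L[ℝ] E => A.det) (ContinuousLinearMap.id ℝ E) A) 0 := by
    refine HasFDerivAt.comp_hasDerivAt (l := fun A : E →L[ℝ] E => A.det) 0 ?_ hline
    simpa using hd
  let e := Module.finBasis ℝ E
  let M := LinearMap.toMatrix e e (A : E →ₗ[ℝ] E)
  have h3 : ∀ r : ℝ, (ContinuousLinearMap.id ℝ E + r • A).det = (1 + r • M).det := fun r => by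
    rw [ContinuousLinearMap.det, ← LinearMap.det_toMatrix e]
    congr 1
    simp [M]
  have h4 : HasDerivAt (fun r : ℝ => (ContinuousLinearMap.id ℝ E + r • A).det) M.trace 0 := by
    rw [funext fun r => (h3 r).trans (Matrix.det_one_add_smul r M)]
    have h5 := ((Polynomial.hasDerivAt
      (Matrix.det (1 + (Polynomial.X : Polynomial ℝ) • M.map Polynomial.C)).divX.divX (0 : ℝ)).mul
      ((hasDerivAt_id (0 : ℝ)).pow 2))
    have h6 := (((hasDerivAt_id (0 : ℝ)).const_mul M.trace).const_add 1).add h5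
    refine (h6.congr_deriv (by simp)).congr_of_eventuallyEq (Eventually.of_forall fun r => ?_)
    simp
  have h7 : LinearMap.trace ℝ E A = M.trace := LinearMap.trace_eq_matrix_trace ℝ e _
  rw [h7, ← h2.unique h4]
  refine HasFDerivAt.comp_hasDerivAt (l := fun A : E →L[ℝ] E => A.det) t ?_ hW
  rw [h1]
  exact hd

/-- The evolution of a divergence-free field preserves the volume. -/
theorem IsSmoothEvolution.measurePreserving [MeasurableSpace E] [BorelSpace E] (μ : Measure E)
    [μ.IsAddHaarMeasure] {b : ℝ → E → E} {S : ℝ → ℝ → E → E} (h : IsSmoothEvolution b S)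
    (hdiv : ∀ t ζ, LinearMap.trace ℝ E (fderiv ℝ (b t) ζ : E →L[ℝ] E) = 0) (t s : ℝ) :
    MeasurePreserving (S t s) μ μ := by
  have hdiff := fun t s => (h.contDiff_space t s).differentiable (by simp)
  have hfd : ∀ τ t s ζ, fderiv ℝ (S τ s) ζ =
      fderiv ℝ (S τ t) (S t s ζ) ∘L fderiv ℝ (S t s) ζ := fun τ t s ζ => by
    have : S τ s = S τ t ∘ S t s := funext fun ζ => (h.trans τ t s ζ).symm
    rw [this, fderiv_comp _ (hdiff τ t _) (hdiff t s _)]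
  have hself : ∀ t ζ, fderiv ℝ (S t t) ζ = ContinuousLinearMap.id ℝ E := fun t ζ => by
    rw [show S t t = id from funext fun ζ => h.self t ζ, fderiv_id]
  -- Restarting at time `t` factors the Jacobian as `det DS(τ,t) · det DS(t,s)`; the first factor is
  -- at the identity when `τ = t`, so its derivative is the divergence.
  have hdet0 : ∀ s ζ t, HasDerivAt (fun τ => (fderiv ℝ (S τ s) ζ).det) 0 t := by
    intro s ζ t
    have h1 := hasDerivAt_det (h.hasDerivAt_fderiv t t (S t s ζ)) (hself _ _)
    rw [hself, ContinuousLinearMap.comp_id, hdiv] at h1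
    have h2 := h1.mul_const (fderiv ℝ (S t s) ζ).det
    rw [zero_mul] at h2
    refine h2.congr_of_eventuallyEq (Eventually.of_forall fun τ => ?_)
    simp only
    rw [hfd τ t s ζ]
    exact LinearMap.det_comp _ _
  have hdet : ∀ ζ, (fderiv ℝ (S t s) ζ).det = 1 := fun ζ => by
    have := is_const_of_deriv_eq_zero (fun τ => (hdet0 s ζ τ).differentiableAt)
      (fun τ => (hdet0 s ζ τ).deriv) t s
    rw [this, hself]
    simp [ContinuousLinearMap.det]
  have hmeas : Measurable (S t s) := (h.contDiff_space t s).continuous.measurable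
  refine ⟨hmeas, ?_⟩
  have key := map_withDensity_abs_det_fderiv_eq_addHaar μ (s := univ) (f := S t s)
    (f' := fderiv ℝ (S t s)) MeasurableSet.univ.nullMeasurableSet
    (fun ζ _ => ((hdiff t s) ζ).hasFDerivAt.hasFDerivWithinAt)
    (fun x _ y _ hxy => by rw [← h.left_inv t s x, hxy, h.left_inv])
  have himg : S t s '' univ = univ :=
    image_univ_of_surjective fun ζ => ⟨S s t ζ, h.left_inv s t ζ⟩
  simpa [hdet, himg] using key

end Liouville

/-! ### The divergence of the Vlasov field -/

/-- The derivative of `v̂` is symmetric, while `· × m` is antisymmetric, so their composition has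
trace zero. -/
lemma trace_cross_fderiv_relVelocity (v m : Space) :
    ∑ i : Fin 3, cross (fderiv ℝ relVelocity v (EuclideanSpace.single i 1)) m i = 0 := by
  rw [(hasFDerivAt_relVelocity v).fderiv]
  simp [Fin.sum_univ_three, cross, cross_apply, EuclideanSpace.inner_single_right]
  ring

/-- Only the diagonal blocks count: `v̂` does not depend on `x`, and at fixed `x` the fields `e`,
`m` are constant, so the velocity block is the trace just computed. -/
lemma trace_fderiv_eq_zero {b : Phase → Phase} (hb : Differentiable ℝ b)
    (hfst : ∀ z, (b z).1 = relVelocity z.2)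
    (hsnd : ∀ x, ∃ e m : Space, ∀ v, (b (x, v)).2 = e + cross (relVelocity v) m) (z : Phase) :
    LinearMap.trace ℝ Phase (fderiv ℝ b z : Phase →L[ℝ] Phase) = 0 := by
  obtain ⟨e, m, hem⟩ := hsnd z.1
  have hbd := (hb z).hasFDerivAt
  have h1 : ∀ h : Space, (fderiv ℝ b z (h, 0)).1 = 0 := by
    intro h
    have e1 := (ContinuousLinearMap.fst ℝ Space Space).hasFDerivAt.comp z hbd
    have e2 : HasFDerivAt (fun z : Phase => relVelocity z.2) _ z :=
      ((hasFDerivAt_relVelocity z.2).differentiableAt.hasFDerivAt).comp z hasFDerivAt_snd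
    have e3 : (ContinuousLinearMap.fst ℝ Space Space) ∘ b = fun z => relVelocity z.2 :=
      funext hfst
    rw [e3] at e1
    simpa using congrArg (fun T : Phase →L[ℝ] Space => T (h, 0)) (e1.unique e2)
  have h2 : ∀ w : Space, (fderiv ℝ b z (0, w)).2 = cross (fderiv ℝ relVelocity z.2 w) m := by
    intro w
    have e1 : HasFDerivAt (fun v => (b (z.1, v)).2) _ z.2 :=
      (ContinuousLinearMap.snd ℝ Space Space).hasFDerivAt.comp z.2
        (HasFDerivAt.comp z.2 (f := fun v => (z.1, v)) hbd (hasFDerivAt_prodMk_right z.1 z.2))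
    have e2 : HasFDerivAt (fun v => e + crossL.flip m (relVelocity v)) _ z.2 :=
      ((crossL.flip m).hasFDerivAt.comp z.2
        (hasFDerivAt_relVelocity z.2).differentiableAt.hasFDerivAt).const_add e
    have e3 : (fun v => (b (z.1, v)).2) = fun v => e + crossL.flip m (relVelocity v) :=
      funext fun v => hem v
    rw [e3] at e1
    simpa using congrArg (fun T : Space →L[ℝ] Space => T w) (e1.unique e2)
  let B := (EuclideanSpace.basisFun (Fin 3) ℝ).toBasis
  rw [LinearMap.trace_eq_matrix_trace ℝ (B.prod B), Matrix.trace, Fintype.sum_sum_type]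
  simp only [Matrix.diag_apply, LinearMap.toMatrix_apply, Module.Basis.prod_repr_inl,
    Module.Basis.prod_repr_inr, ContinuousLinearMap.coe_coe]
  have e1 : ∀ i, B.prod B (Sum.inl i) = (B i, 0) := fun i => by
    ext1 <;> simp
  have e2 : ∀ i, B.prod B (Sum.inr i) = (0, B i) := fun i => by
    ext1 <;> simp
  simp only [e1, e2, h1, h2]
  simpa [B] using trace_cross_fderiv_relVelocity z.2 m

instance instIsAddHaarMeasurePhase : (volume : Measure Phase).IsAddHaarMeasure :=
  Measure.prod.instIsAddHaarMeasure volume volume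

/-! ### The self-consistent evolution -/

/-- Integration against the density `g` over a compact set. -/
def integralAgainst {s : Set Phase} (hs : IsCompact s) (g : Phase → ℝ) (hg : Continuous g)
    [CompactSpace s] : C(s, Space) →L[ℝ] Space :=
  have hint : ∀ u : C(s, Space), Integrable (fun z : s => g z • u z)
      (Measure.comap Subtype.val (volume : Measure Phase)) := fun u => by
    have : IsFiniteMeasure (Measure.comap Subtype.val (volume : Measure Phase) : Measure s) :=
      ⟨by
        rw [comap_subtype_coe_apply hs.measurableSet]
        simpa using hs.measure_lt_top⟩
    have hc : Continuous fun z : s => g z • u z := by fun_prop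
    obtain ⟨C, hC⟩ := isCompact_univ.exists_bound_of_continuousOn hc.continuousOn
    exact Integrable.of_bound hc.aestronglyMeasurable C
      (Eventually.of_forall fun z => hC z trivial)
  LinearMap.mkContinuous
    { toFun := fun u => ∫ z : s, g z • u z ∂(Measure.comap Subtype.val volume)
      map_add' := fun u w => by
        rw [← integral_add (hint u) (hint w)]
        simp
      map_smul' := fun c u => by
        rw [RingHom.id_apply, ← integral_smul]
        simp only [ContinuousMap.smul_apply]
        exact integral_congr_ae (Eventually.of_forall fun z => smul_comm _ _ _) }
    (∫ z : s, |g z| ∂(Measure.comap Subtype.val volume))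
    (fun u => by
      rw [← integral_mul_const]
      -- Testing against a constant unit vector yields the integrability of `|g|`.
      have h1 := (hint (ContinuousMap.const s (EuclideanSpace.single 0 1))).norm
      simp only [ContinuousMap.const_apply, norm_smul] at h1
      simp at h1
      refine norm_integral_le_of_norm_le (h1.mul_const _) (Eventually.of_forall fun z => ?_)
      rw [norm_smul]
      exact mul_le_mul_of_nonneg_left (u.norm_coe_le_norm z) (norm_nonneg _))

lemma integralAgainst_tsupport {g : Phase → ℝ} (hg : Continuous g) (hs : IsCompact (tsupport g))
    [CompactSpace (tsupport g)] (u : C(tsupport g, Space)) (F : Phase → Space)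
    (hF : ∀ z : tsupport g, u z = F z) :
    integralAgainst hs g hg u = ∫ z, g z • F z := by
  change ∫ z : tsupport g, g z • u z ∂(Measure.comap Subtype.val volume) = _
  simp only [hF]
  rw [integral_subtype_comap hs.measurableSet (fun z => g z • F z)]
  refine setIntegral_eq_integral_of_forall_compl_eq_zero fun z hz => ?_
  rw [image_eq_zero_of_notMem_tsupport hz, zero_smul]

lemma integrable_smul_of_hasCompactSupport {X F : Type} [TopologicalSpace X] [MeasurableSpace X]
    [OpensMeasurableSpace X] {μ : Measure X} [IsFiniteMeasureOnCompacts μ] [NormedAddCommGroup F]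
    [NormedSpace ℝ F] [SecondCountableTopologyEither X F] {g : X → ℝ} (hg : Continuous g)
    (hc : HasCompactSupport g) {u : X → F} (hu : Continuous u) : Integrable (fun x => g x • u x) μ :=
  Continuous.integrable_of_hasCompactSupport (hg.smul hu) (hc.smul_right (f' := u))

/-- The field generated by the initial density `g` transported by `S`. -/
def transportedField (𝒦 : Space → Space) (σE σB : ℝ) (g : Phase → ℝ) (S : ℝ → ℝ → Phase → Phase)
    (t : ℝ) (ζ : Phase) : Phase :=
  (relVelocity ζ.2, ∫ z, g z • interaction 𝒦 σE σB (ζ, S t 0 z))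

lemma exists_selfConsistent_evolution {𝒦 : Space → Space} (hs : ContDiff ℝ ∞ 𝒦)
    (hb : BoundedLipschitz 𝒦) (σE σB : ℝ) {g : Phase → ℝ} (hg : Continuous g)
    (hc : HasCompactSupport g) :
    ∃ S : ℝ → ℝ → Phase → Phase, IsSmoothEvolution (transportedField 𝒦 σE σB g S) S := by
  have : CompactSpace (tsupport g) := isCompact_iff_compactSpace.1 hc
  let K := tsupport g
  let β : Phase → Phase := fun ζ => (relVelocity ζ.2, 0)
  have hβ : ContDiff ℝ ∞ β := (contDiff_relVelocity.comp contDiff_snd).prodMk contDiff_const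
  let k : Phase × Phase → Phase := fun p => (0, interaction 𝒦 σE σB p)
  have hk : ContDiff ℝ ∞ k := contDiff_const.prodMk (contDiff_interaction hs σE σB)
  have hβb : BoundedLipschitz β :=
    BoundedLipschitz.clm (ContinuousLinearMap.inl ℝ Space Space)
      (boundedLipschitz_relVelocity.comp LipschitzWith.prod_snd)
  have hkb : BoundedLipschitz k :=
    BoundedLipschitz.clm (ContinuousLinearMap.inr ℝ Space Space)
      (boundedLipschitz_interaction hb σE σB)
  let I : C(K, Phase) →L[ℝ] Phase := ContinuousLinearMap.inr ℝ Space Space ∘L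
    integralAgainst hc.isCompact g hg ∘L
      (ContinuousLinearMap.snd ℝ Space Space).compLeftContinuous ℝ K
  obtain ⟨⟨Lβ, hLβ⟩, Mβ, hMβ⟩ := hβb
  obtain ⟨⟨Lk, hLk⟩, Mk, hMk⟩ := hkb
  obtain ⟨Z, S, h1, h2, h3, h4, h5, h6⟩ := exists_meanField_flow hβ hk I hLβ hLk hMβ hMk
    -- Each particle starts at its own label, so its position at time `t` is `S t 0` of the label
    -- and the mean field becomes `transportedField`.
    (⟨Subtype.val, continuous_subtype_val⟩ : C(K, Phase))
  have key : ∀ t ζ, meanField β hk.continuous I (Z t, ζ) = transportedField 𝒦 σE σB g S t ζ := by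
    intro t ζ
    have e : integralAgainst hc.isCompact g hg
        ((ContinuousLinearMap.snd ℝ Space Space).compLeftContinuous ℝ K
          (superpose k hk.continuous (pairConst (Z t, ζ)))) =
        ∫ z, g z • interaction 𝒦 σE σB (ζ, S t 0 z) := by
      refine integralAgainst_tsupport hg hc.isCompact _ _ fun z => ?_
      change interaction 𝒦 σE σB (ζ, Z t z) = _
      rw [h6]
      rfl
    have e2 : meanField β hk.continuous I (Z t, ζ) = β ζ +
        (0, integralAgainst hc.isCompact g hg
        ((ContinuousLinearMap.snd ℝ Space Space).compLeftContinuous ℝ K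
          (superpose k hk.continuous (pairConst (Z t, ζ))))) := rfl
    rw [e2, e]
    simp [β, transportedField]
  simp only [key] at h2 h4
  exact ⟨S, h1, h2, h3, h4, h5⟩

lemma trace_transportedField {𝒦 : Space → Space} (hs : ContDiff ℝ ∞ 𝒦) (σE σB : ℝ)
    {g : Phase → ℝ} (hg : Continuous g) (hc : HasCompactSupport g) {S : ℝ → ℝ → Phase → Phase}
    (h : IsSmoothEvolution (transportedField 𝒦 σE σB g S) S) (t : ℝ) (ζ : Phase) :
    LinearMap.trace ℝ Phase (fderiv ℝ (transportedField 𝒦 σE σB g S t) ζ : Phase →L[ℝ] Phase)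
      = 0 := by
  have hb := h.contDiff_field_space t
  refine trace_fderiv_eq_zero (hb.differentiable (by simp)) (fun z => rfl) (fun x => ?_) ζ
  have hS : Continuous (S t 0) := (h.contDiff_space t 0).continuous
  have hK := hs.continuous
  have hv := contDiff_relVelocity.continuous
  have hEc : Continuous fun z => σE • 𝒦 (x - (S t 0 z).1) := by fun_prop
  have hBc : Continuous fun z => σB • crossL (relVelocity (S t 0 z).2) (𝒦 (x - (S t 0 z).1)) := by
    fun_prop
  have hE := integrable_smul_of_hasCompactSupport (μ := volume) hg hc hEc
  have hB := integrable_smul_of_hasCompactSupport (μ := volume) hg hc hBc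
  refine ⟨∫ z, g z • σE • 𝒦 (x - (S t 0 z).1),
    ∫ z, g z • σB • crossL (relVelocity (S t 0 z).2) (𝒦 (x - (S t 0 z).1)), fun v => ?_⟩
  have e1 := (crossL (relVelocity v)).integral_comp_comm hB
  rw [← crossL_apply, ← e1, ← integral_add hE ((crossL (relVelocity v)).integrable_comp hB)]
  refine integral_congr_ae (Eventually.of_forall fun z => ?_)
  simp [interaction, smul_add]

lemma measurePreserving_evolution {𝒦 : Space → Space} (hs : ContDiff ℝ ∞ 𝒦) (σE σB : ℝ)
    {g : Phase → ℝ} (hg : Continuous g) (hc : HasCompactSupport g) {S : ℝ → ℝ → Phase → Phase}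
    (h : IsSmoothEvolution (transportedField 𝒦 σE σB g S) S) (t s : ℝ) :
    MeasurePreserving (S t s) (volume : Measure Phase) volume :=
  h.measurePreserving volume (trace_transportedField hs σE σB hg hc h) t s

instance instBorelSpaceOnePointPhase : BorelSpace (OnePoint Phase) := ⟨rfl⟩

instance instBorelSpacePathSpace (T : ℝ) : BorelSpace (PathSpace T) := ⟨rfl⟩

/-! ### Transport of a density by a volume preserving evolution -/

section Transport

variable {b : ℝ → Phase → Phase} {S : ℝ → ℝ → Phase → Phase}

/-- The evolution as a homeomorphism. -/
def IsSmoothEvolution.homeomorph (h : IsSmoothEvolution b S) (t s : ℝ) : Phase ≃ₜ Phase where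
  toFun := S t s
  invFun := S s t
  left_inv := h.left_inv t s
  right_inv := h.left_inv s t
  continuous_toFun := (h.contDiff_space t s).continuous
  continuous_invFun := (h.contDiff_space s t).continuous

lemma IsSmoothEvolution.contDiff_from (h : IsSmoothEvolution b S) (s : ℝ) :
    ContDiff ℝ ∞ (fun p : ℝ × Phase => S p.1 s p.2) :=
  h.contDiff.comp (contDiff_fst.prodMk (contDiff_const.prodMk contDiff_snd))

lemma IsSmoothEvolution.contDiff_to (h : IsSmoothEvolution b S) (t : ℝ) :
    ContDiff ℝ ∞ (fun p : ℝ × Phase => S t p.1 p.2) :=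
  h.contDiff.comp (contDiff_const.prodMk (contDiff_fst.prodMk contDiff_snd))

lemma integral_comp_evolution (h : IsSmoothEvolution b S)
    (hmp : ∀ t s, MeasurePreserving (S t s) (volume : Measure Phase) volume)
    {F : Type} [NormedAddCommGroup F] [NormedSpace ℝ F] (t s : ℝ) (u : Phase → F) :
    ∫ z, u (S t s z) = ∫ z, u z :=
  (hmp t s).integral_comp (h.homeomorph t s).measurableEmbedding u

/-- The density `g` transported by the evolution `S` from time `0` on. -/
def transported (S : ℝ → ℝ → Phase → Phase) (g : Phase → ℝ) (t : ℝ) (z : Phase) : ℝ := g (S 0 t z)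

lemma transported_evolution (h : IsSmoothEvolution b S) (g : Phase → ℝ) (t : ℝ) (z : Phase) :
    transported S g t (S t 0 z) = g z := by rw [transported, h.left_inv]

lemma contDiff_transported (h : IsSmoothEvolution b S) {g : Phase → ℝ} (hg : ContDiff ℝ ∞ g) :
    ContDiff ℝ ∞ (fun p : ℝ × Phase => transported S g p.1 p.2) :=
  hg.comp (h.contDiff_to 0)

lemma hasCompactSupport_transported (h : IsSmoothEvolution b S) {g : Phase → ℝ}
    (hc : HasCompactSupport g) (t : ℝ) : HasCompactSupport (transported S g t) :=
  hc.comp_homeomorph (h.homeomorph 0 t)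

lemma continuous_transported (h : IsSmoothEvolution b S) {g : Phase → ℝ}
    (hg : Continuous g) (t : ℝ) : Continuous (transported S g t) :=
  hg.comp (h.contDiff_space 0 t).continuous

lemma integrable_transported (h : IsSmoothEvolution b S) {g : Phase → ℝ}
    (hg : Continuous g) (hc : HasCompactSupport g) (t : ℝ) : Integrable (transported S g t) :=
  (continuous_transported h hg t).integrable_of_hasCompactSupport
    (hasCompactSupport_transported h hc t)

/-- Change of variables `z ↦ S t 0 z`: averages against the transported density become averages
against `g`. -/
lemma integral_smul_transported (h : IsSmoothEvolution b S)
    (hmp : ∀ t s, MeasurePreserving (S t s) (volume : Measure Phase) volume)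
    {F : Type} [NormedAddCommGroup F] [NormedSpace ℝ F] (g : Phase → ℝ) (t : ℝ) (u : Phase → F) :
    ∫ z, transported S g t z • u z = ∫ z, g z • u (S t 0 z) := by
  rw [← integral_comp_evolution h hmp t 0]
  simp only [transported_evolution h]

/-- The transported density is constant along characteristics. -/
lemma fderiv_transported (h : IsSmoothEvolution b S) {g : Phase → ℝ} (hg : ContDiff ℝ ∞ g)
    (t : ℝ) (z : Phase) :
    fderiv ℝ (fun p : ℝ × Phase => transported S g p.1 p.2) (t, z) (1, b t z) = 0 := by
  have h1 : HasDerivAt (fun τ => (τ, S τ 0 (S 0 t z))) (1, b t z) t := by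
    have := (hasDerivAt_id t).prodMk (h.hasDerivAt t 0 (S 0 t z))
    rwa [h.left_inv] at this
  have hF := ((contDiff_transported h hg).differentiable (by simp) (t, z)).hasFDerivAt
  have h2 := HasFDerivAt.comp_hasDerivAt
    (l := fun p : ℝ × Phase => transported S g p.1 p.2) t (by rwa [h.left_inv]) h1
  have h3 : (fun p : ℝ × Phase => transported S g p.1 p.2) ∘ (fun τ => (τ, S τ 0 (S 0 t z))) =
      fun _ => g (S 0 t z) := funext fun τ => transported_evolution h g τ _
  rw [h3] at h2
  exact h2.unique (hasDerivAt_const t _)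

lemma map_withDensity_transported (h : IsSmoothEvolution b S)
    (hmp : ∀ t s, MeasurePreserving (S t s) (volume : Measure Phase) volume)
    {g : Phase → ℝ} (hg : Continuous g) (t : ℝ) :
    (volume.withDensity fun z => ENNReal.ofReal (g z)).map (S t 0) =
      volume.withDensity fun z => ENNReal.ofReal (transported S g t z) := by
  have hm : Measurable fun z => ENNReal.ofReal (transported S g t z) :=
    (continuous_transported h hg t).measurable.ennreal_ofReal
  ext A hA
  rw [Measure.map_apply (hmp t 0).measurable hA, withDensity_apply _ hA,
    withDensity_apply _ ((hmp t 0).measurable hA), ← (hmp t 0).setLIntegral_comp_preimage hA hm]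
  simp only [transported_evolution h]

/-! ### The transported density as a Lagrangian solution -/

lemma isMaximalRegularFlow_evolution (h : IsSmoothEvolution b S)
    (hmp : ∀ t s, MeasurePreserving (S t s) (volume : Measure Phase) volume) (T : ℝ) :
    IsMaximalRegularFlow b T (fun _ _ => 0) (fun _ _ => T) S where
  measurable_Tm _ _ := measurable_const
  measurable_Tp _ _ := measurable_const
  Tm_mem s hs z := ⟨le_rfl, hs.1, id⟩
  Tp_mem s hs z := ⟨hs.2, le_rfl, id⟩
  measurable_flow s _ :=
    (h.contDiff_from s).continuous.measurable.comp measurable_subtype_coe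
  trajectory s _ := Eventually.of_forall fun z => by
    have hc : ContDiff ℝ ∞ fun t => S t s z :=
      (h.contDiff_from s).comp (contDiff_id.prodMk contDiff_const)
    refine ⟨fun a c _ _ => ?_, h.self s z, Eventually.of_forall fun t _ => h.hasDerivAt t s z⟩
    exact (hc.of_le (by exact_mod_cast le_top)).contDiffOn.absolutelyContinuousOnInterval
  compression s _ := ⟨1, fun t _ => by
    rw [one_smul]
    conv_rhs => rw [← (hmp t s).map_eq]
    exact Measure.map_mono Measure.restrict_le_self (hmp t s).measurable⟩
  forward s _ := Eventually.of_forall fun z => Or.inl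
    ⟨rfl, fun t _ => (h.hasDerivAt t s z).continuousAt.continuousWithinAt⟩
  backward s _ := Eventually.of_forall fun z => Or.inl
    ⟨rfl, fun t _ => (h.hasDerivAt t s z).continuousAt.continuousWithinAt⟩

/-- The trajectories of the evolution which start at time `0`, as curves in `ℝ⁶ ∪ {∞}`. -/
def IsSmoothEvolution.path (h : IsSmoothEvolution b S) (T : ℝ) : C(Phase, PathSpace T) :=
  ContinuousMap.curry
    ⟨fun p : Phase × Icc (0 : ℝ) T => (S p.2 0 p.1 : OnePoint Phase),
      OnePoint.continuous_coe.comp ((h.contDiff_from 0).continuous.comp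
        ((continuous_subtype_val.comp continuous_snd).prodMk continuous_fst))⟩

lemma IsSmoothEvolution.path_apply (h : IsSmoothEvolution b S) (T : ℝ) (z : Phase)
    (t : Icc (0 : ℝ) T) : h.path T z t = (S t 0 z : OnePoint Phase) := rfl

/-- Phase space is σ-compact and the path space Hausdorff, so the range is a countable union of
closed sets. This lets the image measure be concentrated on genuine trajectories. -/
lemma measurableSet_range_path (h : IsSmoothEvolution b S) (T : ℝ) :
    MeasurableSet (range (h.path T)) := by
  obtain ⟨K, hK, hU⟩ := isSigmaCompact_range (h.path T).continuous
  rw [← hU]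
  exact MeasurableSet.iUnion fun n => (hK n).isClosed.measurableSet

lemma measurable_coe_onePoint : Measurable fun z : Phase => (z : OnePoint Phase) :=
  OnePoint.continuous_coe.measurable

lemma measurable_eval_path {T : ℝ} (t : Icc (0 : ℝ) T) :
    Measurable fun γ : PathSpace T => γ t :=
  (continuous_eval_const t).measurable

/-- The measure is the image of `g ℒ⁶` under `z ↦ S · 0 z`; concentration is then the cocycle
identity. -/
lemma exists_isTransported_evolution (h : IsSmoothEvolution b S)
    (hmp : ∀ t s, MeasurePreserving (S t s) (volume : Measure Phase) volume)
    {g : Phase → ℝ} (hg : Continuous g) (hc : HasCompactSupport g) (T : ℝ) :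
    ∃ Λ : Measure (PathSpace T), IsTransported Λ (fun _ _ => 0) (fun _ _ => T) S ∧
      ∀ t : Icc (0 : ℝ) T, Λ.map (fun γ => γ t) = onCompactification
        (volume.withDensity fun z => ENNReal.ofReal (transported S g t z)) := by
  let μ : Measure Phase := volume.withDensity fun z => ENNReal.ofReal (g z)
  have hμ : IsFiniteMeasure μ := isFiniteMeasure_withDensity_ofReal
    (hg.integrable_of_hasCompactSupport hc).hasFiniteIntegral
  have hpm : Measurable (h.path T) := (h.path T).continuous.measurable
  have hmarg : ∀ t : Icc (0 : ℝ) T, (μ.map (h.path T)).map (fun γ => γ t) = onCompactification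
      (volume.withDensity fun z => ENNReal.ofReal (transported S g t z)) := fun t => by
    rw [onCompactification, ← map_withDensity_transported h hmp hg t,
      Measure.map_map (measurable_eval_path t) hpm,
      Measure.map_map measurable_coe_onePoint (hmp t 0).measurable]
    rfl
  refine ⟨μ.map (h.path T), ⟨Measure.isFiniteMeasure_map _ _, fun t => ?_, fun s => ?_⟩, hmarg⟩
  · rw [hmarg t]
    exact (withDensity_absolutelyContinuous _ _).map measurable_coe_onePoint
  · filter_upwards [ae_map_mem_range (h.path T) (measurableSet_range_path h T) μ] with γ hγ
    obtain ⟨ζ, rfl⟩ := hγ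
    intro z hz t _
    rw [h.path_apply, OnePoint.coe_eq_coe] at hz
    rw [h.path_apply, ← hz, h.trans]

/-- In Lagrangian coordinates the integrand is `g z` times the time derivative of `φ (t, S t 0 z)`,
whose integral over time vanishes for each `z`. -/
lemma isDistributionalSolution_transported (h : IsSmoothEvolution b S)
    (hmp : ∀ t s, MeasurePreserving (S t s) (volume : Measure Phase) volume)
    {g : Phase → ℝ} (hg : ContDiff ℝ ∞ g) (hc : HasCompactSupport g) (T : ℝ) :
    IsDistributionalSolution b T (transported S g) := by
  have hf := (contDiff_transported h hg).continuous
  have hb := h.contDiff_field.continuous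
  refine ⟨(hf.smul hb).locallyIntegrable.locallyIntegrableOn _, fun φ hφ hφc _ => ?_⟩
  let D : ℝ × Phase → ℝ := fun p => fderiv ℝ φ p (1, b p.1 p.2)
  have hD : Continuous D :=
    (hφ.continuous_fderiv (by simp)).clm_apply (continuous_const.prodMk hb)
  have hDc : HasCompactSupport D := (hφc.fderiv ℝ).mono' fun p hp => by
    refine subset_tsupport _ fun h0 => hp ?_
    simp [D, h0]
  let B := Prod.fst '' tsupport D
  have hB : IsCompact B := hDc.isCompact.image continuous_fst
  have hSc := (h.contDiff_from 0).continuous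
  have hi1 : Integrable (fun p : ℝ × Phase => D p * transported S g p.1 p.2) :=
    (hD.mul hf).integrable_of_hasCompactSupport hDc.mul_right
  have hi2 : Integrable (fun p : ℝ × Phase => g p.2 * D (p.1, S p.1 0 p.2)) := by
    have hcont : Continuous (fun p : ℝ × Phase => g p.2 * D (p.1, S p.1 0 p.2)) :=
      (hg.continuous.comp continuous_snd).mul (hD.comp (continuous_fst.prodMk hSc))
    refine hcont.integrable_of_hasCompactSupport
      (HasCompactSupport.intro (hB.prod hc.isCompact) fun p hp => ?_)
    by_cases h1 : p.2 ∈ tsupport g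
    · have h2 : (p.1, S p.1 0 p.2) ∉ tsupport D := fun h3 => hp ⟨⟨_, h3, rfl⟩, h1⟩
      rw [image_eq_zero_of_notMem_tsupport h2, mul_zero]
    · rw [image_eq_zero_of_notMem_tsupport h1, zero_mul]
  have hzero : ∀ z, ∫ t, D (t, S t 0 z) = 0 := fun z => by
    have hder : ∀ t, HasDerivAt (fun t => φ (t, S t 0 z)) (D (t, S t 0 z)) t := fun t =>
      HasFDerivAt.comp_hasDerivAt (l := φ) t
        (hφ.differentiable (by simp) (t, S t 0 z)).hasFDerivAt
        ((hasDerivAt_id t).prodMk (h.hasDerivAt t 0 z))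
    have hpath : Continuous fun t => (t, S t 0 z) :=
      continuous_id.prodMk (hSc.comp (continuous_id.prodMk continuous_const))
    refine integral_eq_zero_of_hasDerivAt_of_integrable hder ?_ ?_
    · refine (hD.comp hpath).integrable_of_hasCompactSupport
        (HasCompactSupport.intro hB fun t ht =>
          image_eq_zero_of_notMem_tsupport (f := D) (x := (t, S t 0 z)) fun h3 => ?_)
      exact ht ⟨(t, S t 0 z), h3, rfl⟩
    · refine (hφ.continuous.comp hpath).integrable_of_hasCompactSupport
        (HasCompactSupport.intro (hφc.isCompact.image continuous_fst)
          fun t ht => image_eq_zero_of_notMem_tsupport (f := φ) (x := (t, S t 0 z)) fun h3 => ?_)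
      exact ht ⟨(t, S t 0 z), h3, rfl⟩
  calc ∫ p : ℝ × Phase, D p * transported S g p.1 p.2
      = ∫ t, ∫ z, D (t, z) * transported S g t z := by
        rw [Measure.volume_eq_prod, integral_prod _ hi1]
    _ = ∫ t, ∫ z, g z * D (t, S t 0 z) := by
        refine integral_congr_ae (Eventually.of_forall fun t => ?_)
        have := integral_smul_transported h hmp g t fun z => D (t, z)
        simpa only [smul_eq_mul, mul_comm] using this
    _ = ∫ z, ∫ t, g z * D (t, S t 0 z) := integral_integral_swap hi2
    _ = 0 := by simp [integral_const_mul, hzero]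

lemma isLagrangianSolution_transported (h : IsSmoothEvolution b S)
    (hmp : ∀ t s, MeasurePreserving (S t s) (volume : Measure Phase) volume)
    {g : Phase → ℝ} (hg : ContDiff ℝ ∞ g) (hc : HasCompactSupport g) (hg0 : ∀ z, 0 ≤ g z)
    (T : ℝ) : IsLagrangianSolution b T (transported S g) where
  measurable_field := h.contDiff_field.continuous.measurable.comp measurable_subtype_coe
  nonneg t _ := Eventually.of_forall fun z => hg0 _
  measurable_density := (contDiff_transported h hg).continuous.aestronglyMeasurable
  locally_bounded A _ := by
    have hgi := hg.continuous.integrable_of_hasCompactSupport (μ := volume) hc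
    refine ⟨(∫⁻ z, ‖g z‖ₑ).toNNReal, Eventually.of_forall fun t => ?_⟩
    rw [ENNReal.coe_toNNReal hgi.hasFiniteIntegral.ne]
    refine (setLIntegral_le_lintegral _ _).trans_eq ?_
    exact (hmp 0 t).lintegral_comp hg.continuous.measurable.enorm
  distributional := isDistributionalSolution_transported h hmp hg hc T
  locallyIntegrable t _ := (continuous_transported h hg.continuous t).locallyIntegrable
  weakly_continuous φ hφ _ := by
    -- Pulled back to time `0`, the integral has a continuous integrand over a fixed compact set.
    have e : (fun t => ∫ z, φ z * transported S g t z) =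
        fun t => ∫ z in tsupport g, g z * φ (S t 0 z) := funext fun t => by
      rw [setIntegral_eq_integral_of_forall_compl_eq_zero fun z hz => by
        rw [image_eq_zero_of_notMem_tsupport hz, zero_mul]]
      have := integral_smul_transported h hmp g t φ
      simpa only [smul_eq_mul, mul_comm] using this
    rw [e]
    refine (continuous_parametric_integral_of_continuous
      (f := fun t z => g z * φ (S t 0 z)) ?_ hc.isCompact).continuousOn
    exact (hg.continuous.comp continuous_snd).mul (hφ.comp (h.contDiff_from 0).continuous)
  transported := by
    obtain ⟨Λ, h1, h2⟩ := exists_isTransported_evolution h hmp hg.continuous hc T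
    exact ⟨_, _, S, Λ, isMaximalRegularFlow_evolution h hmp T, h1, h2⟩

end Transport

/-! ### Existence -/

lemma vlasovField_transported {𝒦 : Space → Space} (hs : ContDiff ℝ ∞ 𝒦) (hb : BoundedLipschitz 𝒦)
    (σE σB : ℝ) {g : Phase → ℝ} (hg : Continuous g) (hc : HasCompactSupport g)
    {S : ℝ → ℝ → Phase → Phase} (h : IsSmoothEvolution (transportedField 𝒦 σE σB g S) S) :
    vlasovField 𝒦 σE σB (transported S g) = transportedField 𝒦 σE σB g S := by
  funext t z
  refine Prod.ext rfl ?_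
  change acceleration 𝒦 σE σB (transported S g t) z.1 z.2 = _
  rw [acceleration_eq_integral hs.continuous hb σE σB (integrable_transported h hg hc t)]
  exact integral_smul_transported h (measurePreserving_evolution hs σE σB hg hc h) g t _

theorem isSmoothLagrangianSolution_transported {𝒦 : Space → Space} (hs : ContDiff ℝ ∞ 𝒦)
    (hb : BoundedLipschitz 𝒦) (σE σB : ℝ) {g : Phase → ℝ} (hg : ContDiff ℝ ∞ g)
    (hc : HasCompactSupport g) (hg0 : ∀ z, 0 ≤ g z)
    {S : ℝ → ℝ → Phase → Phase} (h : IsSmoothEvolution (transportedField 𝒦 σE σB g S) S) :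
    IsSmoothLagrangianSolution 𝒦 σE σB g (transported S g) where
  smooth := (contDiff_transported h hg).contDiffOn
  nonneg _ _ _ := hg0 _
  integrable t _ := integrable_transported h hg.continuous hc t
  integrable_velocity t _ x := by
    have hf := hasCompactSupport_transported h hc t
    have hcont := continuous_transported h hg.continuous t
    refine Continuous.integrable_of_hasCompactSupport (by fun_prop)
      (HasCompactSupport.intro (hf.isCompact.image continuous_snd) fun v hv =>
        image_eq_zero_of_notMem_tsupport fun h1 => hv ⟨_, h1, rfl⟩)
  vlasov t _ x v := by
    let F : ℝ × Phase → ℝ := fun p => transported S g p.1 p.2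
    have hF := ((contDiff_transported h hg).differentiable (by simp) (t, (x, v))).hasFDerivAt
    have h1 : deriv (fun τ => transported S g τ (x, v)) t = fderiv ℝ F (t, (x, v)) (1, 0) := by
      have := HasFDerivAt.comp_hasDerivAt (l := F) t hF
        ((hasDerivAt_id t).prodMk (hasDerivAt_const t (x, v)))
      exact this.deriv
    have h2 : ∀ w, fderiv ℝ (fun y => transported S g t (y, v)) x w =
        fderiv ℝ F (t, (x, v)) (0, (w, 0)) := fun w => by
      have := HasFDerivAt.comp (g := F) (f := fun y => (t, (y, v))) x hF
        ((hasFDerivAt_const t x).prodMk ((hasFDerivAt_id x).prodMk (hasFDerivAt_const v x)))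
      exact congrArg (fun A : Space →L[ℝ] ℝ => A w) this.fderiv
    have h3 : ∀ w, fderiv ℝ (fun y => transported S g t (x, y)) v w =
        fderiv ℝ F (t, (x, v)) (0, (0, w)) := fun w => by
      have := HasFDerivAt.comp (g := F) (f := fun y => (t, (x, y))) v hF
        ((hasFDerivAt_const t v).prodMk ((hasFDerivAt_const x v).prodMk (hasFDerivAt_id v)))
      exact congrArg (fun A : Space →L[ℝ] ℝ => A w) this.fderiv
    have h4 := fderiv_transported h hg t (x, v)
    rw [← vlasovField_transported hs hb σE σB hg.continuous hc h] at h4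
    rw [h1, h2, h3, ← map_add, ← map_add]
    convert! h4 using 2
    simp [vlasovField]
  initial z := by rw [transported, h.self]
  lagrangian T _ := by
    rw [vlasovField_transported hs hb σE σB hg.continuous hc h]
    exact isLagrangianSolution_transported h
      (measurePreserving_evolution hs σE σB hg.continuous hc h) hg hc hg0 T

/-! ### Absolutely continuous curves -/

lemma absolutelyContinuousOnInterval_clm_comp {F : Type} [NormedAddCommGroup F] [NormedSpace ℝ F]
    (ℓ : F →L[ℝ] ℝ) {w : ℝ → F} {a c : ℝ} (hw : AbsolutelyContinuousOnInterval w a c) :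
    AbsolutelyContinuousOnInterval (fun t => ℓ (w t)) a c := by
  refine squeeze_zero (fun _ => Finset.sum_nonneg fun _ _ => dist_nonneg) (fun E => ?_)
    (by simpa using Tendsto.const_mul ‖ℓ‖ hw)
  rw [Finset.mul_sum]
  exact Finset.sum_le_sum fun i _ => ℓ.lipschitz.dist_le_mul _ _

/-- A norming functional for `w c - w a` reduces to a real absolutely continuous function, for which
the fundamental theorem of calculus holds. -/
lemma norm_sub_le_of_absolutelyContinuous {F : Type} [NormedAddCommGroup F] [NormedSpace ℝ F]
    {w : ℝ → F} {ψ ψ' : ℝ → ℝ} {a c : ℝ} (hac : a ≤ c)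
    (hw : AbsolutelyContinuousOnInterval w a c) (hψ : ∀ t, HasDerivAt ψ (ψ' t) t)
    (hψc : Continuous ψ')
    (hd : ∀ᵐ t, t ∈ Ioo a c → ∃ d, HasDerivAt w d t ∧ ‖d‖ ≤ ψ' t) :
    ‖w c - w a‖ ≤ ψ c - ψ a := by
  obtain ⟨ℓ, hℓ1, hℓ⟩ := exists_dual_vector'' ℝ (w c - w a)
  have hac' := absolutelyContinuousOnInterval_clm_comp ℓ hw
  have hψi := hψc.intervalIntegrable (μ := volume) a c
  rw [← intervalIntegral.integral_eq_sub_of_hasDerivAt (fun t _ => hψ t) hψi]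
  have e : ‖w c - w a‖ = ∫ t in a..c, deriv (fun t => ℓ (w t)) t := by
    rw [hac'.integral_deriv_eq_sub, ← map_sub, hℓ]
    rfl
  rw [e, intervalIntegral.integral_of_le hac, intervalIntegral.integral_of_le hac,
    integral_Ioc_eq_integral_Ioo, integral_Ioc_eq_integral_Ioo]
  have h1 := (intervalIntegrable_iff_integrableOn_Ioo_of_le hac).1 hac'.intervalIntegrable_deriv
  have h2 := (intervalIntegrable_iff_integrableOn_Ioo_of_le hac).1 hψi
  refine setIntegral_mono_on_ae h1 h2 measurableSet_Ioo ?_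
  filter_upwards [hd] with t ht htm
  obtain ⟨d, hd1, hd2⟩ := ht htm
  have h3 : HasDerivAt (fun t => ℓ (w t)) (ℓ d) t := ℓ.hasFDerivAt.comp_hasDerivAt t hd1
  rw [h3.deriv]
  calc ℓ d ≤ ‖ℓ d‖ := le_abs_self _
    _ ≤ 1 * ‖d‖ := ℓ.le_of_opNorm_le hℓ1 d
    _ ≤ ψ' t := by rwa [one_mul]

/-! ### Maximal regular flows of bounded fields -/

/-- `x` is an absolutely continuous solution of `x' = b_t(x)` on `[0, T)` which starts from `z`. -/
structure IsACSolution (b : ℝ → Phase → Phase) (T : ℝ) (x : ℝ → Phase) (z : Phase) : Prop where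
  ac : ∀ t, 0 ≤ t → t < T → AbsolutelyContinuousOnInterval x 0 t
  initial : x 0 = z
  deriv : ∀ᵐ t : ℝ, t ∈ Ioo 0 T → HasDerivAt x (b t (x t)) t

/-- A bounded field moves a point by at most `|C| T`, which excludes the blow-up alternative of
forward maximality. -/
lemma IsMaximalRegularFlow.ae_global {b : ℝ → Phase → Phase} {T : ℝ} (hT : 0 < T)
    {Tm Tp : ℝ → Phase → ℝ} {X : ℝ → ℝ → Phase → Phase} (hX : IsMaximalRegularFlow b T Tm Tp X)
    {C : ℝ} (hC : ∀ t ∈ Ioo 0 T, ∀ y, ‖b t y‖ ≤ C) :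
    ∀ᵐ z : Phase, Tm 0 z = 0 ∧ Tp 0 z = T ∧ IsACSolution b T (fun t => X t 0 z) z := by
  have h0 : (0 : ℝ) ∈ Icc 0 T := ⟨le_rfl, hT.le⟩
  filter_upwards [hX.trajectory 0 h0, hX.forward 0 h0] with z ⟨hac, hz, hd⟩ hf
  have hTm : Tm 0 z = 0 := le_antisymm (hX.Tm_mem 0 h0 z).2.1 (hX.Tm_mem 0 h0 z).1
  have hTp := hX.Tp_mem 0 h0 z
  have hpos := hTp.2.2 hT
  rw [hTm] at hd
  have hac' : ∀ t, 0 ≤ t → t < Tp 0 z → AbsolutelyContinuousOnInterval (fun t => X t 0 z) 0 t := by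
    intro t ht0 ht
    refine hac 0 t ht0 fun r hr => ?_
    rcases hr.1.eq_or_lt with h | h
    · exact Or.inl h.symm
    · exact Or.inr ⟨by rwa [hTm], hr.2.trans_lt ht⟩
  have hTpT : Tp 0 z = T := by
    rcases hf with h | h
    · exact h.1
    · exfalso
      have hbd : ∀ t ∈ Ioo 0 (Tp 0 z), ‖X t 0 z‖ ≤ ‖z‖ + |C| * T := by
        intro t ht
        have h1 := norm_sub_le_of_absolutelyContinuous (ψ := fun r => |C| * r)
          (ψ' := fun _ => |C|) ht.1.le (hac' t ht.1.le ht.2)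
          (fun r => by simpa using (hasDerivAt_id r).const_mul |C|) continuous_const
          (by
            filter_upwards [hd] with r hr hrm
            have hr' : r ∈ Ioo 0 (Tp 0 z) := ⟨hrm.1, hrm.2.trans ht.2⟩
            exact ⟨_, hr hr', (hC r ⟨hr'.1, hr'.2.trans_le hTp.2.1⟩ _).trans (le_abs_self C)⟩)
        simp only [hz, mul_zero, sub_zero] at h1
        have h2 : |C| * t ≤ |C| * T :=
          mul_le_mul_of_nonneg_left (ht.2.le.trans hTp.2.1) (abs_nonneg C)
        have h3 := norm_le_norm_add_norm_sub' (X t 0 z) z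
        linarith
      have h1 := h.eventually (eventually_gt_atTop (‖z‖ + |C| * T))
      have h2 : ∀ᶠ t in 𝓝[<] (Tp 0 z), t ∈ Ioo 0 (Tp 0 z) := Ioo_mem_nhdsLT hpos
      obtain ⟨t, ht1, ht2⟩ := (h1.and h2).exists
      exact absurd (hbd t ht2) (not_le.2 ht1)
  rw [hTpT] at hac' hd
  exact ⟨hTm, hTpT, hac', hz, hd⟩

/-- The flow is Borel only on its domain, but the section of the domain at time `t` has full
measure. -/
lemma IsMaximalRegularFlow.aemeasurable {b : ℝ → Phase → Phase} {T : ℝ} (hT : 0 < T)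
    {Tm Tp : ℝ → Phase → ℝ} {X : ℝ → ℝ → Phase → Phase} (hX : IsMaximalRegularFlow b T Tm Tp X)
    (hg : ∀ᵐ z : Phase, Tm 0 z = 0 ∧ Tp 0 z = T) {t : ℝ} (ht : t ∈ Ioo 0 T) :
    AEMeasurable (X t 0) (volume : Measure Phase) := by
  have h0 : (0 : ℝ) ∈ Icc 0 T := ⟨le_rfl, hT.le⟩
  let A : Set Phase := {z | Tm 0 z < t} ∩ {z | t < Tp 0 z}
  have hA : MeasurableSet A :=
    (measurableSet_lt (hX.measurable_Tm 0 h0) measurable_const).inter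
      (measurableSet_lt measurable_const (hX.measurable_Tp 0 h0))
  have hAae : ∀ᵐ z : Phase, z ∈ A := by
    filter_upwards [hg] with z hz
    exact ⟨by simpa [hz.1] using ht.1, by simpa [hz.2] using ht.2⟩
  rw [← Measure.restrict_eq_self_of_ae_mem hAae]
  refine aemeasurable_restrict_of_measurable_subtype hA ?_
  let j : A → {p : ℝ × Phase | p.1 ∈ lifespan Tm Tp 0 p.2} := fun z =>
    ⟨(t, z), Or.inr ⟨z.2.1, z.2.2⟩⟩
  have hj : Measurable j := (measurable_const.prodMk measurable_subtype_coe).subtype_mk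
  exact (hX.measurable_flow 0 h0).comp hj

/-- The marginals of a measure transported by a global flow are the images of the initial one. -/
lemma IsTransported.marginal_eq_map {b : ℝ → Phase → Phase} {T : ℝ} (hT : 0 < T)
    {Tm Tp : ℝ → Phase → ℝ} {X : ℝ → ℝ → Phase → Phase} (hX : IsMaximalRegularFlow b T Tm Tp X)
    (hg : ∀ᵐ z : Phase, Tm 0 z = 0 ∧ Tp 0 z = T) {Λ : Measure (PathSpace T)}
    (hΛ : IsTransported Λ Tm Tp X) {ν : ℝ → Measure Phase}
    (hν : ∀ t : Icc (0 : ℝ) T, Λ.map (fun γ => γ t) = onCompactification (ν t))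
    (hν0 : ν 0 ≪ volume) {t : ℝ} (ht : t ∈ Ioo 0 T) :
    ν t = (ν 0).map (X t 0) := by
  have hemb : MeasurableEmbedding fun z : Phase => (z : OnePoint Phase) :=
    OnePoint.isOpenEmbedding_coe.measurableEmbedding
  -- A Borel left inverse of the embedding into the compactification; its value `0` at `∞` is
  -- immaterial.
  obtain ⟨r, hrm, hr⟩ := hemb.exists_measurable_extend measurable_id fun _ => ⟨(0 : Phase)⟩
  have hr' : ∀ z : Phase, r z = z := congr_fun hr
  let τ₀ : Icc (0 : ℝ) T := ⟨0, le_rfl, hT.le⟩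
  let τ : Icc (0 : ℝ) T := ⟨t, ht.1.le, ht.2.le⟩
  have hmap : ∀ τ : Icc (0 : ℝ) T, Λ.map (fun γ => r (γ τ)) = ν τ := fun τ => by
    rw [show (fun γ : PathSpace T => r (γ τ)) = r ∘ fun γ => γ τ from rfl,
      ← Measure.map_map hrm (measurable_eval_path τ), hν,
      onCompactification, Measure.map_map hrm measurable_coe_onePoint, hr, Measure.map_id]
  have hXm : AEMeasurable (X t 0) (ν 0) := (hX.aemeasurable hT hg ht).mono_ac hν0
  obtain ⟨V, hVm, hV⟩ := hXm
  rw [Measure.map_congr hV]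
  have hae : ∀ᵐ γ ∂Λ, ∃ z : Phase, γ τ₀ = (z : OnePoint Phase) ∧ (Tm 0 z = 0 ∧ Tp 0 z = T) ∧ X t 0 z = V z := by
    refine ae_of_ae_map (measurable_eval_path τ₀).aemeasurable
      (p := fun q => ∃ z : Phase, q = (z : OnePoint Phase) ∧ (Tm 0 z = 0 ∧ Tp 0 z = T) ∧ X t 0 z = V z) ?_
    rw [hν, onCompactification, hemb.ae_map_iff]
    filter_upwards [hν0.ae_le hg, hV] with z h1 h2
    exact ⟨z, rfl, h1, h2⟩
  have hq : (fun γ : PathSpace T => r (γ τ)) =ᵐ[Λ] fun γ => V (r (γ τ₀)) := by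
    filter_upwards [hae, hΛ.concentrated τ₀] with γ ⟨z, hz, ⟨h1, h2⟩, h3⟩ hc
    have h4 : γ τ = (X t 0 z : OnePoint Phase) := hc z hz τ (by
      change t ∈ Ioo (Tm 0 z) (Tp 0 z)
      rwa [h1, h2])
    rw [h4, hz, hr', hr', h3]
  have hrm₀ : Measurable fun γ : PathSpace T => r (γ τ₀) := hrm.comp (measurable_eval_path τ₀)
  calc ν t = Λ.map (fun γ => r (γ τ)) := (hmap τ).symm
    _ = Λ.map (V ∘ fun γ => r (γ τ₀)) := Measure.map_congr hq
    _ = (Λ.map fun γ => r (γ τ₀)).map V := (Measure.map_map hVm hrm₀).symm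
    _ = (ν 0).map V := by rw [hmap τ₀]

/-! ### Uniqueness -/

/-- The measure with density `h`. -/
def densityMeasure (h : Phase → ℝ) : Measure Phase :=
  volume.withDensity fun z => ENNReal.ofReal (h z)

lemma integral_densityMeasure {F : Type} [NormedAddCommGroup F] [NormedSpace ℝ F] {h : Phase → ℝ}
    (hh : Measurable h) (h0 : ∀ z, 0 ≤ h z) (u : Phase → F) :
    ∫ z, u z ∂(densityMeasure h) = ∫ z, h z • u z := by
  rw [densityMeasure, integral_withDensity_eq_integral_toReal_smul hh.ennreal_ofReal
    (Eventually.of_forall fun _ => ENNReal.ofReal_lt_top)]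
  simp only [ENNReal.toReal_ofReal (h0 _)]

lemma norm_integral_smul_le {h : Phase → ℝ} (hi : Integrable h) (h0 : ∀ z, 0 ≤ h z)
    {u : Phase → Space} {M : ℝ} (hu : ∀ z, ‖u z‖ ≤ M) :
    ‖∫ z, h z • u z‖ ≤ (∫ z, h z) * M := by
  rw [← integral_mul_const]
  refine norm_integral_le_of_norm_le (hi.mul_const M) (Eventually.of_forall fun z => ?_)
  rw [norm_smul, Real.norm_of_nonneg (h0 z)]
  exact mul_le_mul_of_nonneg_left (hu z) (h0 z)

/-- Two mean-field evolutions of the same initial density `g`, one of them only defined almost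
everywhere, have the same trajectories. -/
lemma meanField_trajectories_unique {𝒦 : Space → Space} (hs : ContDiff ℝ ∞ 𝒦)
    (hb : BoundedLipschitz 𝒦) (σE σB : ℝ) {g : Phase → ℝ} (hg : Continuous g)
    (hc : HasCompactSupport g) (hg0 : ∀ z, 0 ≤ g z)
    {T : ℝ} {x y : ℝ → Phase → Phase}
    (hxm : ∀ t ∈ Ioo 0 T, AEMeasurable (x t) volume)
    (hym : ∀ t ∈ Ioo 0 T, AEMeasurable (y t) volume)
    {b₁ b₂ : ℝ → Phase → Phase}
    (hbx : ∀ t ∈ Ioo 0 T, ∀ ζ, b₁ t ζ =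
      (relVelocity ζ.2, ∫ z, g z • interaction 𝒦 σE σB (ζ, x t z)))
    (hby : ∀ t ∈ Ioo 0 T, ∀ ζ, b₂ t ζ =
      (relVelocity ζ.2, ∫ z, g z • interaction 𝒦 σE σB (ζ, y t z)))
    (hx : ∀ᵐ z : Phase, IsACSolution b₁ T (fun t => x t z) z)
    (hy : ∀ᵐ z : Phase, IsACSolution b₂ T (fun t => y t z) z) :
    ∀ᵐ z : Phase, ∀ t ∈ Ioo 0 T, x t z = y t z := by
  have hgi : Integrable g := hg.integrable_of_hasCompactSupport hc
  have hib := boundedLipschitz_interaction hb σE σB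
  have hic := (contDiff_interaction hs σE σB).continuous
  obtain ⟨⟨L, hL⟩, M, hM⟩ := hib
  obtain ⟨⟨Lv, hLv⟩, -⟩ := boundedLipschitz_relVelocity
  set m := ∫ z, g z with hm
  have hm0 : 0 ≤ m := integral_nonneg hg0
  have hmeas : ∀ {w : ℝ → Phase → Phase}, (∀ t ∈ Ioo 0 T, AEMeasurable (w t) volume) →
      ∀ t ∈ Ioo 0 T, ∀ ζ, Integrable fun z => g z • interaction 𝒦 σE σB (ζ, w t z) :=
    fun {w} hw t ht ζ => hgi.smul_bdd (M : ℝ)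
      (hic.measurable.comp_aemeasurable
        (aemeasurable_const.prodMk (hw t ht))).aestronglyMeasurable
      (Eventually.of_forall fun z => hM _)
  -- Lipschitz constant of the field when test point and particles all move by at most `δ`: `Lv`
  -- from `v̂`, and `m L` from averaging the interaction over the mass `m`.
  let Λ : ℝ := Lv + m * L
  have hΛ0 : 0 ≤ Λ := by positivity
  -- the difference of the fields, given a bound on the distances of the trajectories
  have hdiff : ∀ t ∈ Ioo 0 T, ∀ δ : ℝ, (∀ᵐ z : Phase, ‖x t z - y t z‖ ≤ δ) → ∀ ζ ξ : Phase,
      ‖ζ - ξ‖ ≤ δ → ‖b₁ t ζ - b₂ t ξ‖ ≤ Λ * δ := by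
    intro t ht δ hδ ζ ξ hζ
    have hδ0 : 0 ≤ δ := (norm_nonneg _).trans hζ
    rw [hbx t ht, hby t ht, show Λ * δ = Lv * δ + m * L * δ from add_mul _ _ _]
    refine max_le ?_ ?_
    · have h1 := hLv.dist_le_mul ζ.2 ξ.2
      rw [dist_eq_norm, dist_eq_norm] at h1
      have h2 : ‖ζ.2 - ξ.2‖ ≤ δ := (norm_snd_le (ζ - ξ)).trans hζ
      have h3 : 0 ≤ m * L * δ := by positivity
      have h4 : (Lv : ℝ) * ‖ζ.2 - ξ.2‖ ≤ Lv * δ := by gcongr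
      change ‖relVelocity ζ.2 - relVelocity ξ.2‖ ≤ _
      linarith
    · change ‖(∫ z, g z • interaction 𝒦 σE σB (ζ, x t z)) -
        ∫ z, g z • interaction 𝒦 σE σB (ξ, y t z)‖ ≤ _
      rw [← integral_sub (hmeas hxm t ht ζ) (hmeas hym t ht ξ)]
      have h1 : ∀ᵐ z : Phase, ‖g z • interaction 𝒦 σE σB (ζ, x t z) -
          g z • interaction 𝒦 σE σB (ξ, y t z)‖ ≤ g z * (L * δ) := by
        filter_upwards [hδ] with z hz
        rw [← smul_sub, norm_smul, Real.norm_of_nonneg (hg0 z)]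
        refine mul_le_mul_of_nonneg_left ?_ (hg0 z)
        have h2 := hL.dist_le_mul (ζ, x t z) (ξ, y t z)
        rw [dist_eq_norm] at h2
        refine h2.trans (mul_le_mul_of_nonneg_left ?_ L.2)
        exact max_le (by rwa [dist_eq_norm]) (by rwa [dist_eq_norm])
      refine (norm_integral_le_of_norm_le (hgi.mul_const _) h1).trans ?_
      rw [integral_mul_const, ← hm]
      have h3 : 0 ≤ Lv * δ := by positivity
      linarith
  have hbound : ∀ {b : ℝ → Phase → Phase} {w : ℝ → Phase → Phase}, (∀ t ∈ Ioo 0 T, ∀ ζ, b t ζ =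
      (relVelocity ζ.2, ∫ z, g z • interaction 𝒦 σE σB (ζ, w t z))) →
      ∀ t ∈ Ioo 0 T, ∀ ζ, ‖b t ζ‖ ≤ 1 + m * M := by
    intro b w hbw t ht ζ
    rw [hbw t ht]
    have h2 : 0 ≤ m * M := by positivity
    refine max_le ((norm_relVelocity_le _).trans (by linarith)) ?_
    exact (norm_integral_smul_le hgi hg0 fun z => hM _).trans (by linarith)
  have hstep : ∀ {ψ ψ' : ℝ → ℝ} {z : Phase}, IsACSolution b₁ T (fun t => x t z) z →
      IsACSolution b₂ T (fun t => y t z) z → (∀ t, HasDerivAt ψ (ψ' t) t) → Continuous ψ' →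
      0 ≤ ψ 0 → (∀ t ∈ Ioo 0 T, ‖b₁ t (x t z) - b₂ t (y t z)‖ ≤ ψ' t) →
      ∀ t ∈ Ioo 0 T, ‖x t z - y t z‖ ≤ ψ t := by
    intro ψ ψ' z h1 h2 hψ hψc hψ0 hle t ht
    have h3 := norm_sub_le_of_absolutelyContinuous ht.1.le
      ((h1.ac t ht.1.le ht.2).fun_sub (h2.ac t ht.1.le ht.2)) hψ hψc (by
        filter_upwards [h1.deriv, h2.deriv] with r hr1 hr2 hr
        have hr' : r ∈ Ioo 0 T := ⟨hr.1, hr.2.trans ht.2⟩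
        exact ⟨_, (hr1 hr').sub (hr2 hr'), hle r hr'⟩)
    rw [h1.initial, h2.initial, sub_self, sub_zero] at h3
    linarith
  set A : ℝ := (1 + m * M) + (1 + m * M) with hA
  have hA0 : 0 ≤ A := by positivity
  -- With the weight `exp (κ t)`, integrating the Lipschitz bound gains the factor `Λ / κ ≤ 1 / 2`;
  -- the extra `1` keeps `κ` positive.
  set κ : ℝ := 2 * Λ + 1 with hκ
  have hκ0 : 0 < κ := by positivity
  -- Iterating explicit bounds off null sets replaces Gronwall for an essential supremum over
  -- trajectories, and countably many null sets are discarded at the end.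
  have hind : ∀ n : ℕ, ∀ᵐ z : Phase, ∀ t ∈ Ioo 0 T,
      ‖x t z - y t z‖ ≤ A * T / 2 ^ n * Real.exp (κ * t) := by
    intro n
    induction n with
    | zero =>
      filter_upwards [hx, hy] with z h1 h2 t ht
      have h3 := hstep (ψ := fun r => A * r) (ψ' := fun _ => A) h1 h2
        (fun r => by simpa using (hasDerivAt_id r).const_mul A) continuous_const (by simp)
        (fun r hr => (norm_sub_le _ _).trans
          (add_le_add (hbound hbx r hr _) (hbound hby r hr _))) t ht
      have hT : 0 ≤ T := (ht.1.trans ht.2).le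
      have h4 : 1 ≤ Real.exp (κ * t) := Real.one_le_exp (mul_nonneg hκ0.le ht.1.le)
      calc ‖x t z - y t z‖ ≤ A * t := h3
        _ ≤ A * T * 1 := by rw [mul_one]; exact mul_le_mul_of_nonneg_left ht.2.le hA0
        _ ≤ A * T / 2 ^ 0 * Real.exp (κ * t) := by
          rw [pow_zero, div_one]
          exact mul_le_mul_of_nonneg_left h4 (mul_nonneg hA0 hT)
    | succ n ih =>
      filter_upwards [hx, hy, ih] with z h1 h2 h3 t ht
      have hT : 0 ≤ T := (ht.1.trans ht.2).le
      have hB : 0 ≤ A * T / 2 ^ (n + 1) := by positivity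
      refine hstep (ψ := fun r => A * T / 2 ^ (n + 1) * Real.exp (κ * r))
        (ψ' := fun r => A * T / 2 ^ (n + 1) * (Real.exp (κ * r) * κ)) h1 h2 (fun r => ?_)
        (by fun_prop) (by positivity) (fun r hr => ?_) t ht
      · have := (((hasDerivAt_id r).const_mul κ).exp).const_mul (A * T / 2 ^ (n + 1))
        simpa using this
      · have h4 : ∀ᵐ z : Phase, ‖x r z - y r z‖ ≤ A * T / 2 ^ n * Real.exp (κ * r) := by
          filter_upwards [ih] with z hz using hz r hr
        refine (hdiff r hr _ h4 _ _ (h3 r hr)).trans ?_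
        have h5 : A * T / 2 ^ n = 2 * (A * T / 2 ^ (n + 1)) := by
          rw [pow_succ]
          field_simp
        have h6 : 0 ≤ A * T / 2 ^ (n + 1) * Real.exp (κ * r) := by positivity
        rw [h5, hκ]
        nlinarith
  filter_upwards [ae_all_iff.2 hind] with z hz t ht
  have hlim : Tendsto (fun n : ℕ => A * T / 2 ^ n * Real.exp (κ * t)) atTop (𝓝 0) := by
    have h1 := tendsto_pow_atTop_nhds_zero_of_lt_one (r := (1 / 2 : ℝ)) (by norm_num) (by norm_num)
    have h2 := (h1.const_mul (A * T)).mul_const (Real.exp (κ * t))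
    rw [mul_zero, zero_mul] at h2
    refine h2.congr fun n => ?_
    rw [one_div, inv_pow, div_eq_mul_inv]
  have h0 := ge_of_tendsto' hlim fun n => hz n t ht
  exact sub_eq_zero.1 (norm_le_zero_iff.1 h0)

/-- A smooth Lagrangian solution is the initial density transported by the self-consistent
evolution. -/
theorem IsSmoothLagrangianSolution.eq_transported {𝒦 : Space → Space} (hs : ContDiff ℝ ∞ 𝒦)
    (hb : BoundedLipschitz 𝒦) {σE σB : ℝ} {g : Phase → ℝ} (hg : Continuous g)
    (hc : HasCompactSupport g) (hg0 : ∀ z, 0 ≤ g z)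
    {S : ℝ → ℝ → Phase → Phase} (h : IsSmoothEvolution (transportedField 𝒦 σE σB g S) S)
    {f : ℝ → Phase → ℝ} (hf : IsSmoothLagrangianSolution 𝒦 σE σB g f) {t₀ : ℝ} (ht₀ : 0 < t₀) :
    f t₀ = transported S g t₀ := by
  have hmp := measurePreserving_evolution hs σE σB hg hc h
  have hfc : ∀ t, 0 ≤ t → Continuous (f t) := fun t ht =>
    hf.smooth.continuousOn.comp_continuous (f := fun z : Phase => (t, z)) (by fun_prop)
      fun z => ⟨ht, trivial⟩
  have hf0 : f 0 = g := funext hf.initial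
  let T : ℝ := t₀ + 1
  have hT : 0 < T := by positivity
  have hL := hf.lagrangian T hT
  obtain ⟨Tm, Tp, X, Λ, hX, hΛ, hmarg⟩ := hL.transported
  -- conservation of mass
  have hmass : ∀ t ∈ Ioo 0 T, ∫ z, f t z = ∫ z, g z := by
    have key : ∀ t ∈ Icc 0 T, ∫⁻ z, ENNReal.ofReal (f t z) = Λ univ := by
      intro t ht
      have h1 := congrArg (fun ν => ν univ) (hmarg ⟨t, ht⟩)
      simp only [onCompactification] at h1
      rw [Measure.map_apply (measurable_eval_path _) MeasurableSet.univ,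
        Measure.map_apply measurable_coe_onePoint MeasurableSet.univ, preimage_univ, preimage_univ,
        withDensity_apply _ MeasurableSet.univ, Measure.restrict_univ] at h1
      exact h1.symm
    intro t ht
    rw [integral_eq_lintegral_of_nonneg_ae (Eventually.of_forall (hf.nonneg t ht.1.le))
        (hfc t ht.1.le).aestronglyMeasurable,
      integral_eq_lintegral_of_nonneg_ae (Eventually.of_forall hg0) hg.aestronglyMeasurable,
      key t ⟨ht.1.le, ht.2.le⟩, ← hf0, key 0 ⟨le_rfl, hT.le⟩]
  obtain ⟨M, hM⟩ := (boundedLipschitz_interaction hb σE σB).bounded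
  -- Conservation of mass is what bounds the field uniformly in time.
  have hfield : ∀ t ∈ Ioo 0 T, ∀ y, ‖vlasovField 𝒦 σE σB f t y‖ ≤ 1 + (∫ z, g z) * M := by
    intro t ht y
    have hm0 : 0 ≤ (∫ z, g z) * M := mul_nonneg (integral_nonneg hg0) M.2
    refine max_le ((norm_relVelocity_le _).trans (by linarith)) ?_
    change ‖acceleration 𝒦 σE σB (f t) y.1 y.2‖ ≤ _
    rw [acceleration_eq_integral hs.continuous hb σE σB (hf.integrable t ht.1.le), ← hmass t ht]
    rw [← hmass t ht] at hm0
    exact (norm_integral_smul_le (hf.integrable t ht.1.le) (hf.nonneg t ht.1.le)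
      fun z => hM _).trans (by linarith)
  have hglob := hX.ae_global hT hfield
  have hgood : ∀ᵐ z : Phase, Tm 0 z = 0 ∧ Tp 0 z = T := by
    filter_upwards [hglob] with z hz using ⟨hz.1, hz.2.1⟩
  have hpush : ∀ t ∈ Ioo 0 T, densityMeasure (f t) = (densityMeasure g).map (X t 0) := by
    intro t ht
    have := hΛ.marginal_eq_map hT hX hgood (ν := fun t => densityMeasure (f t)) hmarg
      (withDensity_absolutelyContinuous _ _) ht
    rwa [hf0] at this
  have hXm : ∀ t ∈ Ioo 0 T, AEMeasurable (X t 0) (volume : Measure Phase) := fun t ht =>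
    hX.aemeasurable hT hgood ht
  have hXg : ∀ t ∈ Ioo 0 T, AEMeasurable (X t 0) (densityMeasure g) := fun t ht =>
    (hXm t ht).mono_ac (withDensity_absolutelyContinuous _ _)
  -- The push-forward identity closes the equation: the field of `f` is the mean field of the
  -- particles `X t 0 z` weighted by `g`.
  have hbX : ∀ t ∈ Ioo 0 T, ∀ ζ, vlasovField 𝒦 σE σB f t ζ =
      (relVelocity ζ.2, ∫ z, g z • interaction 𝒦 σE σB (ζ, X t 0 z)) := by
    intro t ht ζ
    refine Prod.ext rfl ?_
    change acceleration 𝒦 σE σB (f t) ζ.1 ζ.2 = _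
    have hic : Continuous fun z => interaction 𝒦 σE σB (ζ, z) :=
      (contDiff_interaction hs σE σB).continuous.comp (by fun_prop)
    rw [acceleration_eq_integral hs.continuous hb σE σB (hf.integrable t ht.1.le),
      ← integral_densityMeasure (hfc t ht.1.le).measurable (hf.nonneg t ht.1.le), hpush t ht,
      integral_map (hXg t ht) hic.aestronglyMeasurable, integral_densityMeasure hg.measurable hg0]
  have hS : ∀ z, IsACSolution (transportedField 𝒦 σE σB g S) T (fun t => S t 0 z) z := fun z =>
    ⟨fun t _ _ => ((h.contDiff_from 0).comp (contDiff_id.prodMk contDiff_const)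
      |>.of_le (by exact_mod_cast le_top)).contDiffOn.absolutelyContinuousOnInterval,
      h.self 0 z, Eventually.of_forall fun t _ => h.hasDerivAt t 0 z⟩
  have huniq := meanField_trajectories_unique hs hb σE σB hg hc hg0 (x := fun t => X t 0)
    (y := fun t => S t 0) hXm (fun t _ => (hmp t 0).measurable.aemeasurable) hbX
    (fun t _ ζ => rfl) (hglob.mono fun z hz => hz.2.2) (Eventually.of_forall hS)
  have ht : t₀ ∈ Ioo 0 T := ⟨ht₀, lt_add_one t₀⟩
  have hmeas : densityMeasure (f t₀) = densityMeasure (transported S g t₀) := by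
    have h1 : X t₀ 0 =ᵐ[densityMeasure g] S t₀ 0 :=
      (withDensity_absolutelyContinuous _ _).ae_le (huniq.mono fun z hz => hz t₀ ht)
    rw [hpush t₀ ht, Measure.map_congr h1]
    exact map_withDensity_transported h hmp hg t₀
  have hSc := continuous_transported h hg t₀
  have hae : f t₀ =ᵐ[volume] transported S g t₀ := by
    have h1 := (withDensity_eq_iff_of_sigmaFinite
      (hfc t₀ ht₀.le).measurable.ennreal_ofReal.aemeasurable
      hSc.measurable.ennreal_ofReal.aemeasurable).1 hmeas
    filter_upwards [h1] with z hz
    exact (ENNReal.ofReal_eq_ofReal_iff (hf.nonneg t₀ ht₀.le z) (hg0 _)).1 hz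
  exact ((hfc t₀ ht₀.le).ae_eq_iff_eq volume hSc).1 hae

end RelativisticVlasov

end

theorem proposition3p3
    (η : Space → ℝ) (hη_smooth : ContDiff ℝ ∞ η) (hη_supp : HasCompactSupport η)
    (hη_nonneg : ∀ x, 0 ≤ η x) (hη_int : ∫ x, η x = 1)
    (σE σB : ℝ) (hσE : σE ∈ ({-1, 0, 1} : Set ℝ)) (hσB : σB ∈ ({0, 1} : Set ℝ))
    (g : Phase → ℝ) (hg_smooth : ContDiff ℝ ∞ g) (hg_supp : HasCompactSupport g)
    (hg_nonneg : ∀ z, 0 ≤ g z) :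
    ∃ f : ℝ → Phase → ℝ,
      IsSmoothLagrangianSolution (mollifiedKernel η) σE σB g f ∧
      ∀ f' : ℝ → Phase → ℝ, IsSmoothLagrangianSolution (mollifiedKernel η) σE σB g f' →
        ∀ t, 0 ≤ t → ∀ z, f' t z = f t z := by
  have hs := contDiff_mollifiedKernel hη_smooth hη_supp
  have hb := boundedLipschitz_mollifiedKernel hη_smooth hη_supp
  obtain ⟨S, h⟩ := exists_selfConsistent_evolution hs hb σE σB hg_smooth.continuous hg_supp
  have hf := isSmoothLagrangianSolution_transported hs hb σE σB hg_smooth hg_supp hg_nonneg h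
  refine ⟨transported S g, hf, fun f' hf' t ht z => ?_⟩
  rcases ht.eq_or_lt with rfl | ht
  · rw [hf'.initial, hf.initial]
  · exact congr_fun (hf'.eq_transported hs hb hg_smooth.continuous hg_supp hg_nonneg h ht) z
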